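/- Fix the incoherent basis $\{|i\rangle\}_{i=1}^d$ of $\mathbb{C}^d$; logarithms are to base $2$. A \emph{uniformly coherent state of size $k\ge 1$} is a unit vector $|\Psi\rangle=\frac{1}{\sqrt k}\sum_{j\in J}e^{i\theta_j}|j\rangle$ with $J\subseteq\{1,\dots,d\}$, $|J|=k$ and $\theta_j\in\mathbb{R}$; write $\Psi=|\Psi\rangle\langle\Psi|$, and let $\Psi_{m}$ be the density matrix of the state $\frac1{\sqrt m}\sum_{j=1}^m|j\rangle$ of $\mathbb{C}^m$. An \emph{incoherent operator} is a matrix that maps each basis vector to a multiple of a basis vector. A \emph{physically incoherent operation} (PIO) on a $D$-dimensional system is a map $\Lambda(X)=\sum_{\alpha,\beta}p_\alpha U_{\alpha,\beta}\Pi_{\beta|\alpha}X\,\Pi_{\beta|\alpha}U_{\alpha,\beta}^\dagger$ (finite sum), where $p$ is a probability distribution, the $U_{\alpha,\beta}$ are incoherent unitaries and, for each $\alpha$, the $\Pi_{\beta|\alpha}$ are projectors onto spans of basis vectors with $\sum_\beta\Pi_{\beta|\alpha}=\mathbb{1}$. Between systems of different dimensions, a PIO is a trace-preserving map of the form $X\mapsto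 W^\dagger\Lambda(VXV^\dagger)W$, with $V,W$ incoherent isometries from the input and the output space into some $\mathbb{C}^D$ and $\Lambda$ a PIO on $\mathbb{C}^D$. The \emph{PIO coherence cost} of a state (density matrix) $\rho$ on $\mathbb{C}^d$ is $$C_{c,\mathrm{PIO}}(\rho)=\inf\Big\{r\ge 0:\ \lim_{n\to\infty}\ \inf_{\Lambda\in\mathrm{PIO}}\big\|\Lambda\big(\Psi_{2^{\lfloor rn\rfloor}}\big)-\rho^{\otimes n}\big\|_1=0\Big\},$$ where $\|\cdot\|_1$ is the trace norm, $\Lambda$ runs over the PIO from $\mathbb{C}^{2^{\lfloor rn\rfloor}}$ to $(\mathbb{C}^d)^{\otimes n}$ with the product basis, and $\inf\emptyset=+\infty$. \textbf{Theorem.} For every $d$ and every state $\rho$ on $\mathbb{C}^d$, the PIO coherence cost equals the \emph{uniform coherence of formation}: $$C_{c,\mathrm{PIO}}(\rho)=C_f^{\mathcal U}(\rho):=\inf\sum_\alpha p_\alpha\log k_\alpha ,$$ where the infimum runs over all finite convex decompositions $\rho=\sum_\alpha p_\alpha\Psi_\alpha$ into uniformly coherent states $\Psi_\alpha$ of size $k_\alpha$,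 and is $+\infty$ if no such decomposition exists. -/

import Mathlib

open Filter Topology Matrix
open scoped ComplexOrder

namespace Coherence

noncomputable section

/-- A (mixed) quantum state: a positive semidefinite matrix of unit trace, written in the
incoherent basis, which is indexed by `ι`. -/
def IsState {ι : Type*} [Fintype ι] (ρ : Matrix ι ι ℂ) : Prop :=
  ρ.PosSemidef ∧ ρ.trace = 1

/-- The density matrix `|ψ⟩⟨ψ|` of a vector `ψ`. -/
def pureDensity {ι : Type*} (ψ : ι → ℂ) : Matrix ι ι ℂ :=
  Matrix.vecMulVec ψ (star ψ)

/-- `ψ` is a uniformly coherent state vector of size `k`: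
`ψ = k^(-1/2) ∑_{j ∈ J} e^{i θ_j} |j⟩` for some set `J` of `k ≥ 1` basis labels. -/
def IsUniformlyCoherent {ι : Type*} [DecidableEq ι] (k : ℕ) (ψ : ι → ℂ) : Prop :=
  1 ≤ k ∧ ∃ (J : Finset ι) (θ : ι → ℝ), J.card = k ∧
    ∀ i, ψ i = if i ∈ J then ((1 / Real.sqrt k : ℝ) : ℂ) * Complex.exp (θ i * Complex.I) else 0

/-- The canonical maximally coherent state vector (all phases zero) in dimension `m`. -/
def maxCoherent (m : ℕ) : Fin m → ℂ :=
  fun _ => ((1 / Real.sqrt m : ℝ) : ℂ)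

/-- The `n`-fold tensor power of a matrix, with rows and columns labelled by strings of length `n`. -/
def tensorPower {ι : Type*} (ρ : Matrix ι ι ℂ) (n : ℕ) :
    Matrix (Fin n → ι) (Fin n → ι) ℂ :=
  Matrix.of fun x y => ∏ i, ρ (x i) (y i)

/-- The trace norm `‖A‖₁ = Tr √(Aᴴ A)`, that is, the sum of the singular values of `A`. -/
def traceNorm {ι : Type*} [Fintype ι] [DecidableEq ι] (A : Matrix ι ι ℂ) : ℝ :=
  ∑ i, Real.sqrt ((Matrix.isHermitian_conjTranspose_mul_self A).eigenvalues i)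

/-- An incoherent operator: `K |i⟩ = c i |f i⟩` for every basis label `i`. -/
def IsIncoherentOperator {ι κ : Type*} [DecidableEq κ] (K : Matrix κ ι ℂ) : Prop :=
  ∃ (f : ι → κ) (c : ι → ℂ), ∀ j i, K j i = if j = f i then c i else 0

/-- An incoherent isometry. When `κ = ι` these are the incoherent unitaries. -/
def IsIncoherentIsometry {ι κ : Type*} [Fintype κ] [DecidableEq ι] [DecidableEq κ]
    (V : Matrix κ ι ℂ) : Prop :=
  IsIncoherentOperator V ∧ Vᴴ * V = 1

/-- The incoherent projector `∑_{i ∈ I} |i⟩⟨i|`. -/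
def incoherentProjector {ι : Type*} [DecidableEq ι] (I : Finset ι) : Matrix ι ι ℂ :=
  Matrix.diagonal fun i => if i ∈ I then 1 else 0

/-- Physically incoherent operations with equal input and output dimension:
`Λ(X) = ∑_{α,β} p_α U_{α,β} Π_{β|α} X Π_{β|α} U_{α,β}ᴴ`, where `p` is a probability distribution,
the `U_{α,β}` are incoherent unitaries and, for each `α`, the incoherent projectors `Π_{β|α}`
add up to the identity. (The projectors may vanish, so a common range for `β` is no restriction.) -/
def IsSquarePIO {ι : Type*} [Fintype ι] [DecidableEq ι]
    (Λ : Matrix ι ι ℂ →ₗ[ℂ] Matrix ι ι ℂ) : Prop :=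
  ∃ (a b : ℕ) (p : Fin a → ℝ) (U : Fin a → Fin b → Matrix ι ι ℂ)
    (I : Fin a → Fin b → Finset ι),
    (∀ α, 0 ≤ p α) ∧ ∑ α, p α = 1 ∧
    (∀ α β, IsIncoherentIsometry (U α β)) ∧
    (∀ α, ∑ β, incoherentProjector (I α β) = 1) ∧
    ∀ X, Λ X = ∑ α, ∑ β, (p α : ℂ) •
      (U α β * incoherentProjector (I α β) * X * incoherentProjector (I α β) * (U α β)ᴴ)

/-- Physically incoherent operations between systems of arbitrary dimensions: trace-preserving
maps that arise from a physically incoherent operation on a common larger system by lifting the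
input with an incoherent isometry `V` and compressing the output along an incoherent isometry
`W`. -/
def IsPIO {ι κ : Type*} [Fintype ι] [DecidableEq ι] [Fintype κ] [DecidableEq κ]
    (Λ : Matrix ι ι ℂ →ₗ[ℂ] Matrix κ κ ℂ) : Prop :=
  (∀ X, (Λ X).trace = X.trace) ∧
  ∃ (D : ℕ) (Λ' : Matrix (Fin D) (Fin D) ℂ →ₗ[ℂ] Matrix (Fin D) (Fin D) ℂ)
    (V : Matrix (Fin D) ι ℂ) (W : Matrix (Fin D) κ ℂ),
    IsSquarePIO Λ' ∧ IsIncoherentIsometry V ∧ IsIncoherentIsometry W ∧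
    ∀ X, Λ X = Wᴴ * Λ' (V * X * Vᴴ) * W

/-- The least trace-norm error in preparing `n` copies of `ρ` by a physically incoherent operation
from a maximally coherent state of dimension `2 ^ m`, i.e. from `m` coherence bits. -/
def dilutionError {ι : Type*} [Fintype ι] [DecidableEq ι] (ρ : Matrix ι ι ℂ) (m n : ℕ) : ℝ :=
  ⨅ Λ : {Λ : Matrix (Fin (2 ^ m)) (Fin (2 ^ m)) ℂ →ₗ[ℂ]
      Matrix (Fin n → ι) (Fin n → ι) ℂ // IsPIO Λ},
    traceNorm (Λ.1 (pureDensity (maxCoherent (2 ^ m))) - tensorPower ρ n)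

/-- The rate `r ≥ 0` is achievable for the dilution of coherence bits into copies of `ρ`. -/
def IsDilutionRate {ι : Type*} [Fintype ι] [DecidableEq ι] (ρ : Matrix ι ι ℂ) (r : ℝ) : Prop :=
  0 ≤ r ∧ Tendsto (fun n : ℕ => dilutionError ρ ⌊r * n⌋₊ n) atTop (𝓝 0)

/-- The coherence cost under physically incoherent operations (`⊤` if no rate is achievable). -/
def coherenceCostPIO {ι : Type*} [Fintype ι] [DecidableEq ι] (ρ : Matrix ι ι ℂ) : EReal :=
  sInf {x : EReal | ∃ r : ℝ, IsDilutionRate ρ r ∧ x = (r : EReal)}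

/-- The uniform coherence of formation: the infimum of `∑ p_α log₂ k_α` over the decompositions
`ρ = ∑ p_α |ψ_α⟩⟨ψ_α|` into uniformly coherent states `ψ_α` of size `k_α` (`⊤` if there are none). -/
def uniformCoherenceOfFormation {ι : Type*} [DecidableEq ι] (ρ : Matrix ι ι ℂ) : EReal :=
  sInf {x : EReal | ∃ (a : ℕ) (p : Fin a → ℝ) (k : Fin a → ℕ) (ψ : Fin a → ι → ℂ),
    (∀ α, 0 ≤ p α) ∧ ∑ α, p α = 1 ∧ (∀ α, IsUniformlyCoherent (k α) (ψ α)) ∧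
    ∑ α, (p α : ℂ) • pureDensity (ψ α) = ρ ∧
    x = ((∑ α, p α * Real.logb 2 (k α) : ℝ) : EReal)}

end

end Coherence

/-! Upper bound on the cost. Cutting the labels of `maxCoherent M` into blocks of size `k` and
measuring the block yields a given uniformly coherent state of size `k`, except on one incomplete
block of weight at most `min 1 (k / M)` (`IsUniformlyCoherent.exists_blockKraus`). A decomposition
of `ρ` with cost `v` induces one of `tensorPower ρ n` whose sizes are products of `n` sizes. For `r
> v` a Chernoff estimate makes the average of the truncated ratios decay exponentially
(`isDilutionRate_of_mem_convexHull`).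

Lower bound. Incoherent isometries, their adjoints and incoherent projectors never change the
modulus of a nonzero amplitude unless they delete it, so a PIO sends `maxCoherent M` to a mixture of
unnormalised flat vectors supported on at most `M` strings (`IsPIO.exists_flat_decomposition`).
Tracing out all tensor factors but one slices a flat vector along coordinate lines, and the slices
are again flat. Averaged over the factors, their cost is at most `logb 2 M` per factor, by the
entropy inequality `sum_log_card_line_le`. The averaged marginals converge to `ρ`, and the convex
hull of the pairs (uniformly coherent state, log size) is compact, so in the limit `ρ` itself has a
decomposition of cost at most `r` (`IsDilutionRate.exists_le_mem_convexHull`). Averaging the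
marginals is what makes the formula single-letter. -/

namespace Coherence

/-! ### An entropy inequality for sets of strings -/

/-- If `Jₓ` is the line through `x` in direction `i`, then
`∑_{x ∈ J} ∑_{i ∈ T} log |J ∩ Jₓ| ≤ |J| log |J|`: the subadditivity of entropy for a uniform
random string in `J`. -/
theorem sum_log_card_line_le {η ι : Type*} [Fintype η] [DecidableEq η] [Fintype ι] [DecidableEq ι]
    (T : Finset η) (J : Finset (η → ι)) :
    ∑ x ∈ J, ∑ i ∈ T, Real.log ((Finset.univ.filter fun a => Function.update x i a ∈ J).card : ℝ)
      ≤ J.card * Real.log J.card := by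
  induction T using Finset.induction_on generalizing J with
  | empty =>
    simpa using mul_nonneg (Nat.cast_nonneg J.card) (Real.log_natCast_nonneg J.card)
  | insert i T hi ih =>
    rcases J.eq_empty_or_nonempty with rfl | hJ
    · simp
    have hN : (0 : ℝ) < J.card := by exact_mod_cast hJ.card_pos
    set N : ℝ := (J.card : ℝ) with hNdef
    let k : (η → ι) → ℕ := fun x => (Finset.univ.filter fun a => Function.update x i a ∈ J).card
    let s : ι → Finset (η → ι) := fun a => J.filter fun x => x i = a
    have hk : ∀ x ∈ J, 0 < k x := fun x hx => Finset.card_pos.2 ⟨x i, by simpa using hx⟩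
    have hs : ∀ x ∈ J, 0 < (s (x i)).card := fun x hx =>
      Finset.card_pos.2 ⟨x, by simpa [s] using hx⟩
    -- Lines in a direction `j ≠ i` stay inside one fibre of `x ↦ x i`, so the induction hypothesis
    -- applies to each fibre `s a` separately.
    have hrest : ∑ x ∈ J, ∑ j ∈ T,
        Real.log ((Finset.univ.filter fun a => Function.update x j a ∈ J).card : ℝ)
        ≤ ∑ x ∈ J, Real.log ((s (x i)).card : ℝ) := by
      rw [← Finset.sum_fiberwise J (fun x : η → ι => x i) fun x => Real.log ((s (x i)).card : ℝ),
        ← Finset.sum_fiberwise J (fun x : η → ι => x i)]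
      refine Finset.sum_le_sum fun a _ => ?_
      have h1 : ∑ x ∈ J with x i = a, Real.log ((s (x i)).card : ℝ)
          = (s a).card * Real.log (s a).card := by
        rw [Finset.sum_congr rfl (g := fun _ => Real.log ((s a).card : ℝ))]
        · simp [s]
        · intro x hx
          rw [(Finset.mem_filter.1 hx).2]
      rw [h1]
      refine le_trans (le_of_eq ?_) (ih (s a))
      refine Finset.sum_congr rfl fun x hx => Finset.sum_congr rfl fun j hj => ?_
      have hji : i ≠ j := fun h => hi (h ▸ hj)
      have hxa : x i = a := (Finset.mem_filter.1 hx).2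
      congr 3
      ext b
      simp [s, Function.update_of_ne hji, hxa]
    -- The left side counts triples `(x, a, y)` with `update x i a ∈ J`, `y ∈ J` and `y i = x i`.
    -- The pair `(update x i a, y)` determines the triple, because `y` remembers the overwritten
    -- value `x i`.
    have hcount : ∑ x ∈ J, k x * (s (x i)).card ≤ J.card * J.card := by
      rw [← Finset.card_product, Finset.sum_congr rfl
        (fun x (_ : x ∈ J) => (Finset.card_product _ _).symm), ← Finset.card_sigma]
      refine Finset.card_le_card_of_injOn
        (fun z => (Function.update z.1 i z.2.1, z.2.2)) ?_ ?_
      · rintro ⟨x, a, y⟩ h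
        simp [s] at h
        simp [h]
      · rintro ⟨x, a, y⟩ h ⟨x', a', y'⟩ h' heq
        simp [s] at h h' heq
        obtain ⟨h1, rfl⟩ := heq
        have hx : x = x' := by
          funext j
          by_cases hj : j = i
          · subst hj; rw [← h.2.2.2, ← h'.2.2.2]
          · simpa [Function.update_of_ne hj] using congrFun h1 j
        subst hx
        have := congrFun h1 i
        simp at this
        simp [this]
    -- Gibbs' inequality: `log t ≤ t - 1` at `t = k x * (s (x i)).card / N`, whose sum over `J` is
    -- at most `N` by `hcount`.
    have hgibbs : ∑ x ∈ J, (Real.log (k x) + Real.log ((s (x i)).card : ℝ))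
        ≤ N * Real.log N := by
      have hpt : ∀ x ∈ J, Real.log (k x) + Real.log ((s (x i)).card : ℝ)
          ≤ Real.log N + ((k x * (s (x i)).card : ℕ) / N - 1) := by
        intro x hx
        have h1 : (0 : ℝ) < k x := by exact_mod_cast hk x hx
        have h2 : (0 : ℝ) < (s (x i)).card := by exact_mod_cast hs x hx
        have := Real.log_le_sub_one_of_pos (div_pos (mul_pos h1 h2) hN)
        rw [Real.log_div (by positivity) hN.ne', Real.log_mul h1.ne' h2.ne'] at this
        push_cast
        linarith
      refine (Finset.sum_le_sum hpt).trans ?_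
      rw [Finset.sum_add_distrib, Finset.sum_sub_distrib, ← Finset.sum_div, ← Nat.cast_sum]
      have : ((∑ x ∈ J, k x * (s (x i)).card : ℕ) : ℝ) / N ≤ N := by
        rw [div_le_iff₀ hN, hNdef]
        exact_mod_cast hcount
      simp only [Finset.sum_const, nsmul_eq_mul, mul_one]
      linarith
    calc _ = ∑ x ∈ J, Real.log (k x) + ∑ x ∈ J, ∑ j ∈ T,
          Real.log ((Finset.univ.filter fun a => Function.update x j a ∈ J).card : ℝ) := by
          rw [← Finset.sum_add_distrib]
          exact Finset.sum_congr rfl fun x _ => Finset.sum_insert hi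
      _ ≤ _ := by
          rw [Finset.sum_add_distrib] at hgibbs
          linarith

/-! ### Compactness of convex hulls -/

/-- In finite dimension the convex hull of a compact set is compact. -/
theorem isCompact_convexHull_of_finiteDimensional {E : Type*} [AddCommGroup E] [Module ℝ E]
    [TopologicalSpace E] [ContinuousAdd E] [ContinuousSMul ℝ E] [FiniteDimensional ℝ E]
    {S : Set E} (hS : IsCompact S) : IsCompact (convexHull ℝ S) := by
  rcases S.eq_empty_or_nonempty with rfl | ⟨e, he⟩
  · simp
  set N := Module.finrank ℝ E + 1
  have himage : convexHull ℝ S = (fun q : (Fin N → ℝ) × (Fin N → E) => ∑ i, q.1 i • q.2 i) ''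
      (stdSimplex ℝ (Fin N) ×ˢ Set.univ.pi fun _ => S) := by
    refine Set.Subset.antisymm (fun x hx => ?_) ?_
    · obtain ⟨κ, _, z, w, hz, hind, hw, hw1, rfl⟩ := eq_pos_convex_span_of_mem_convexHull hx
      have hcard : Fintype.card κ ≤ Fintype.card (Fin N) := by
        simpa [N] using hind.card_le_finrank_succ.trans
          (Nat.add_le_add_right (Submodule.finrank_le _) 1)
      obtain ⟨g⟩ := Function.Embedding.nonempty_of_card_le hcard
      -- Carathéodory may give fewer than `N` points; the list is padded with the point `e` at
      -- weight zero, so that one simplex serves all of them.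
      refine ⟨(Function.extend g w 0, Function.extend g z fun _ => e), ⟨⟨fun i => ?_, ?_⟩, ?_⟩, ?_⟩
      · by_cases hi : ∃ j, g j = i
        · obtain ⟨j, rfl⟩ := hi
          simpa [g.injective.extend_apply] using (hw j).le
        · simp [Function.extend_apply' _ _ _ hi]
      · refine (Finset.sum_of_injOn g g.injective.injOn (by simp) ?_ ?_).symm.trans hw1
        · intro i _ hi
          exact Function.extend_apply' _ _ _ (by simpa using hi)
        · intro j _
          simp [g.injective.extend_apply]
      · intro i _
        by_cases hi : ∃ j, g j = i
        · obtain ⟨j, rfl⟩ := hi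
          simpa [g.injective.extend_apply] using hz ⟨j, rfl⟩
        · simpa [Function.extend_apply' _ _ _ hi] using he
      · refine (Finset.sum_of_injOn g g.injective.injOn (by simp) ?_ ?_).symm
        · intro i _ hi
          simp [Function.extend_apply' w (0 : Fin N → ℝ) i (by simpa using hi)]
        · intro j _
          simp [g.injective.extend_apply]
    · rintro _ ⟨⟨w, z⟩, ⟨hw, hz⟩, rfl⟩
      exact (convex_convexHull ℝ S).sum_mem (fun i _ => hw.1 i) hw.2
        fun i _ => subset_convexHull ℝ S (hz i trivial)
  rw [himage]
  exact ((isCompact_stdSimplex ℝ _).prod (isCompact_univ_pi fun _ => hS)).image (by fun_prop)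

/-! ### Trace norm estimates -/

section TraceNorm

variable {ι : Type*} [Fintype ι] [DecidableEq ι]

theorem traceNorm_nonneg (A : Matrix ι ι ℂ) : 0 ≤ traceNorm A :=
  Finset.sum_nonneg fun _ _ => Real.sqrt_nonneg _

/-- The trace norm of a Hermitian matrix is the sum of the moduli of its eigenvalues. -/
theorem traceNorm_eq_sum_abs_eigenvalues {A : Matrix ι ι ℂ} (hA : A.IsHermitian) :
    traceNorm A = ∑ i, |hA.eigenvalues i| := by
  have hsq : Aᴴ * A = Unitary.conjStarAlgAut ℂ _ hA.eigenvectorUnitary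
      (diagonal fun i => ((hA.eigenvalues i ^ 2 : ℝ) : ℂ)) := by
    have hd : (diagonal fun i => ((hA.eigenvalues i ^ 2 : ℝ) : ℂ))
        = diagonal (RCLike.ofReal ∘ hA.eigenvalues) * diagonal (RCLike.ofReal ∘ hA.eigenvalues) := by
      rw [diagonal_mul_diagonal]
      congr 1
      funext i
      simp [sq]
    rw [hd, map_mul, ← hA.spectral_theorem, hA.eq]
  -- The enumerations of the eigenvalues of `Aᴴ * A` and of `A` are unrelated, so they are compared
  -- as multisets of roots of the characteristic polynomial.
  have hroots := (Matrix.isHermitian_conjTranspose_mul_self A).roots_charpoly_eq_eigenvalues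
  have hroots' : (Aᴴ * A).charpoly.roots
      = Multiset.map (fun i => ((hA.eigenvalues i ^ 2 : ℝ) : ℂ)) Finset.univ.val := by
    rw [hsq, Unitary.conjStarAlgAut_apply, charpoly_mul_comm, ← mul_assoc,
      Unitary.coe_star_mul_self, one_mul, charpoly_diagonal, Polynomial.roots_prod]
    · simp only [Polynomial.roots_X_sub_C, Multiset.bind_singleton]
    · exact Finset.prod_ne_zero_iff.2 fun i _ => Polynomial.X_sub_C_ne_zero _
  have h := congrArg (fun s : Multiset ℂ => (s.map fun z => Real.sqrt z.re).sum)
    (hroots.symm.trans hroots')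
  simp only [Multiset.map_map, Function.comp_def, Complex.ofReal_re, Complex.coe_algebraMap,
    Real.sqrt_sq_eq_abs] at h
  exact h

/-- The trace norm of a difference of positive semidefinite matrices. -/
theorem traceNorm_sub_le_of_posSemidef {P Q : Matrix ι ι ℂ} (hP : P.PosSemidef)
    (hQ : Q.PosSemidef) : traceNorm (P - Q) ≤ P.trace.re + Q.trace.re := by
  have hA : (P - Q).IsHermitian := hP.1.sub hQ.1
  -- In an eigenbasis of `P - Q` each eigenvalue is a difference of two nonnegative diagonal
  -- entries, so its modulus is at most their sum.
  set b := hA.eigenvectorBasis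
  have htr : ∀ R : Matrix ι ι ℂ,
      R.trace = ∑ i, star ⇑(b i) ⬝ᵥ R *ᵥ ⇑(b i) := by
    intro R
    have h1 : ∀ i, star ⇑(b i) ⬝ᵥ R *ᵥ ⇑(b i)
        = ((hA.eigenvectorUnitary : Matrix ι ι ℂ)ᴴ * R * hA.eigenvectorUnitary) i i := by
      intro i
      rw [Matrix.mul_assoc, Matrix.mul_apply]
      rfl
    rw [Finset.sum_congr rfl fun i _ => h1 i]
    change _ = ((hA.eigenvectorUnitary : Matrix ι ι ℂ)ᴴ * R * hA.eigenvectorUnitary).trace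
    rw [Matrix.trace_mul_cycle, ← star_eq_conjTranspose,
      Unitary.mul_star_self_of_mem hA.eigenvectorUnitary.2, Matrix.one_mul]
  rw [traceNorm_eq_sum_abs_eigenvalues hA, htr P, htr Q, Complex.re_sum, Complex.re_sum,
    ← Finset.sum_add_distrib]
  refine Finset.sum_le_sum fun i _ => ?_
  have hp : 0 ≤ (star ⇑(b i) ⬝ᵥ P *ᵥ ⇑(b i)).re :=
    (Complex.le_def.1 (hP.dotProduct_mulVec_nonneg ⇑(b i))).1
  have hq : 0 ≤ (star ⇑(b i) ⬝ᵥ Q *ᵥ ⇑(b i)).re :=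
    (Complex.le_def.1 (hQ.dotProduct_mulVec_nonneg ⇑(b i))).1
  rw [hA.eigenvalues_eq, Matrix.sub_mulVec, dotProduct_sub, map_sub]
  change |(star ⇑(b i) ⬝ᵥ P *ᵥ ⇑(b i)).re - (star ⇑(b i) ⬝ᵥ Q *ᵥ ⇑(b i)).re| ≤ _
  rw [abs_le]
  constructor <;> linarith

/-- Sums of entries along the graph of a partial injection are bounded by the trace norm. -/
theorem norm_sum_apply_le_traceNorm {κ : Type*} [Fintype κ] (A : Matrix ι ι ℂ) {g h : κ → ι}
    (hg : g.Injective) (hh : h.Injective) : ‖∑ y, A (g y) (h y)‖ ≤ traceNorm A := by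
  have hH := Matrix.isHermitian_conjTranspose_mul_self A
  set U : Matrix ι ι ℂ := (hH.eigenvectorUnitary : Matrix ι ι ℂ) with hU
  -- A singular value decomposition in disguise: the columns of `A * U` have the singular values as
  -- norms and those of `U` have norm one. Cauchy–Schwarz is applied column by column; injectivity
  -- lets the sums over `y` be dominated by full column sums.
  have hAU : A = (A * U) * Uᴴ := by
    rw [Matrix.mul_assoc, ← star_eq_conjTranspose, hU,
      Unitary.mul_star_self_of_mem hH.eigenvectorUnitary.2, Matrix.mul_one]
  have hentry : ∀ x z, A x z = ∑ j, (A * U) x j * star (U z j) := by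
    intro x z
    conv_lhs => rw [hAU]
    rw [Matrix.mul_apply]
    rfl
  have hcol : ∀ j, ∑ x, ‖(A * U) x j‖ ^ 2 = hH.eigenvalues j := by
    intro j
    have h1 : (((A * U)ᴴ * (A * U)) j j) = (hH.eigenvalues j : ℂ) := by
      have := hH.conjStarAlgAut_star_eigenvectorUnitary
      rw [Unitary.conjStarAlgAut_star_apply] at this
      rw [Matrix.conjTranspose_mul, Matrix.mul_assoc, ← Matrix.mul_assoc Aᴴ, ← Matrix.mul_assoc]
      have h2 := congrFun (congrFun this j) j
      simpa [star_eq_conjTranspose] using h2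
    have h2 : (((A * U)ᴴ * (A * U)) j j) = ((∑ x, ‖(A * U) x j‖ ^ 2 : ℝ) : ℂ) := by
      rw [Matrix.mul_apply]
      push_cast
      refine Finset.sum_congr rfl fun x _ => ?_
      rw [Matrix.conjTranspose_apply, ← Complex.conj_mul']
      rfl
    exact_mod_cast h2.symm.trans h1
  have hUcol : ∀ j, ∑ z, ‖U z j‖ ^ 2 = 1 := by
    intro j
    have h1 : (Uᴴ * U) j j = 1 := by
      rw [← star_eq_conjTranspose, hU, Unitary.star_mul_self_of_mem hH.eigenvectorUnitary.2, Matrix.one_apply_eq]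
    have h2 : (Uᴴ * U) j j = ((∑ x, ‖U x j‖ ^ 2 : ℝ) : ℂ) := by
      rw [Matrix.mul_apply]
      push_cast
      refine Finset.sum_congr rfl fun x _ => ?_
      rw [Matrix.conjTranspose_apply, ← Complex.conj_mul']
      rfl
    exact_mod_cast h2.symm.trans h1
  have hsub : ∀ {f : κ → ι}, f.Injective → ∀ F : ι → ℝ, (∀ x, 0 ≤ F x) →
      ∑ y, F (f y) ≤ ∑ x, F x := by
    intro f hf F hF
    rw [← Finset.sum_image (s := Finset.univ) (g := f) (f := F) hf.injOn]
    exact Finset.sum_le_sum_of_subset_of_nonneg (Finset.subset_univ _) fun x _ _ => hF x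
  simp_rw [hentry]
  rw [Finset.sum_comm]
  refine (norm_sum_le _ _).trans (Finset.sum_le_sum fun j _ => ?_)
  calc ‖∑ y, (A * U) (g y) j * star (U (h y) j)‖
      ≤ ∑ y, ‖(A * U) (g y) j‖ * ‖U (h y) j‖ :=
        (norm_sum_le _ _).trans (Finset.sum_le_sum fun y _ => by rw [norm_mul, norm_star])
    _ ≤ Real.sqrt (∑ y, ‖(A * U) (g y) j‖ ^ 2) * Real.sqrt (∑ y, ‖U (h y) j‖ ^ 2) :=
        Real.sum_mul_le_sqrt_mul_sqrt _ _ _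
    _ ≤ Real.sqrt (hH.eigenvalues j) * 1 := by
        refine mul_le_mul (Real.sqrt_le_sqrt ?_) ?_ (Real.sqrt_nonneg _) (Real.sqrt_nonneg _)
        · rw [← hcol j]
          exact hsub hg (fun x => ‖(A * U) x j‖ ^ 2) fun x => by positivity
        · refine Real.sqrt_le_one.2 ((hUcol j).le.trans' ?_)
          exact hsub hh (fun x => ‖U x j‖ ^ 2) fun x => by positivity
    _ = Real.sqrt (hH.eigenvalues j) := mul_one _

end TraceNorm

/-! ### Uniformly coherent states and the convex hull of their graph -/

section UniformlyCoherent

variable {ι : Type*}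

theorem pureDensity_apply (ψ : ι → ℂ) (i j : ι) : pureDensity ψ i j = ψ i * star (ψ j) := rfl

theorem posSemidef_pureDensity [Fintype ι] (ψ : ι → ℂ) : (pureDensity ψ).PosSemidef :=
  posSemidef_vecMulVec_self_star ψ

theorem trace_pureDensity [Fintype ι] (ψ : ι → ℂ) :
    (pureDensity ψ).trace = ((∑ i, ‖ψ i‖ ^ 2 : ℝ) : ℂ) := by
  push_cast
  exact Finset.sum_congr rfl fun i _ => Complex.mul_conj' (ψ i)

theorem pureDensity_smul (c : ℝ) (ψ : ι → ℂ) :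
    pureDensity (fun i => (c : ℂ) * ψ i) = ((c ^ 2 : ℝ) : ℂ) • pureDensity ψ := by
  ext i j
  simp only [pureDensity_apply, Matrix.smul_apply, smul_eq_mul, star_mul', Complex.star_def,
    Complex.conj_ofReal]
  push_cast
  ring

variable [DecidableEq ι]

/-- A vector is uniformly coherent if and only if its entries have constant modulus on a set of
the right size and vanish elsewhere. -/
theorem isUniformlyCoherent_iff {k : ℕ} {ψ : ι → ℂ} :
    IsUniformlyCoherent k ψ ↔ 1 ≤ k ∧ ∃ J : Finset ι, J.card = k ∧
      ∀ i, ‖ψ i‖ = if i ∈ J then 1 / Real.sqrt k else 0 := by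
  refine and_congr_right fun hk => ⟨?_, ?_⟩
  · rintro ⟨J, θ, hJ, h⟩
    refine ⟨J, hJ, fun i => ?_⟩
    rw [h]
    split_ifs
    · rw [norm_mul, Complex.norm_exp_ofReal_mul_I, mul_one, Complex.norm_real,
        Real.norm_of_nonneg (by positivity)]
    · simp
  · rintro ⟨J, hJ, h⟩
    refine ⟨J, fun i => Complex.arg (ψ i), hJ, fun i => ?_⟩
    have hi := h i
    split_ifs at hi ⊢ with hiJ
    · rw [← hi, Complex.norm_mul_exp_arg_mul_I]
    · exact norm_eq_zero.1 hi

/-- The pairs consisting of a uniformly coherent pure state and the logarithm of its size. -/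
def uniformlyCoherentGraph (ι : Type*) [DecidableEq ι] : Set (Matrix ι ι ℂ × ℝ) :=
  {z | ∃ (k : ℕ) (ψ : ι → ℂ), IsUniformlyCoherent k ψ ∧ z = (pureDensity ψ, Real.logb 2 k)}

/-- There are finitely many supports; for a fixed one the phases range over a compact torus and the
log size is constant. -/
theorem isCompact_uniformlyCoherentGraph [Finite ι] : IsCompact (uniformlyCoherentGraph ι) := by
  have h : uniformlyCoherentGraph ι = ⋃ J ∈ {J : Finset ι | J.Nonempty},
      Set.range fun u : ι → Circle =>
        (pureDensity fun i => if i ∈ J then ((1 / Real.sqrt J.card : ℝ) : ℂ) * u i else 0,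
          Real.logb 2 J.card) := by
    ext z
    simp only [uniformlyCoherentGraph, Set.mem_ofPred_eq, Set.mem_iUnion, Set.mem_range]
    constructor
    · rintro ⟨_, ψ, ⟨hk, J, θ, rfl, hψ⟩, rfl⟩
      refine ⟨J, Finset.card_pos.1 hk, fun i => Circle.exp (θ i), ?_⟩
      rw [funext hψ]
      simp only [Circle.coe_exp]
    · rintro ⟨J, hJ, u, rfl⟩
      refine ⟨J.card, _, isUniformlyCoherent_iff.2 ⟨hJ.card_pos, J, rfl, fun i => ?_⟩, rfl⟩
      split_ifs
      · rw [norm_mul, Circle.norm_coe, mul_one, Complex.norm_real,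
          Real.norm_of_nonneg (by positivity)]
      · simp
  rw [h]
  refine (Set.toFinite _).isCompact_biUnion fun J _ => isCompact_range ?_
  refine Continuous.prodMk ?_ continuous_const
  refine continuous_matrix fun i j => ?_
  simp only [pureDensity_apply]
  refine Continuous.mul ?_ (Continuous.star ?_) <;>
  · split_ifs <;> fun_prop

theorem uniformlyCoherentGraph_nonempty [Nonempty ι] : (uniformlyCoherentGraph ι).Nonempty := by
  obtain ⟨i⟩ := ‹Nonempty ι›
  refine ⟨_, 1, fun j => if j ∈ ({i} : Finset ι) then 1 else 0,
    isUniformlyCoherent_iff.2 ⟨le_rfl, {i}, rfl, fun j => ?_⟩, rfl⟩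
  split_ifs <;> simp

/-- State and cost are both affine in the weights, so decompositions of a given cost become points
of a convex hull, to which compactness applies. -/
theorem mem_convexHull_uniformlyCoherentGraph {ρ : Matrix ι ι ℂ} {v : ℝ} :
    (ρ, v) ∈ convexHull ℝ (uniformlyCoherentGraph ι) ↔
      ∃ (a : ℕ) (p : Fin a → ℝ) (k : Fin a → ℕ) (ψ : Fin a → ι → ℂ),
        (∀ α, 0 ≤ p α) ∧ ∑ α, p α = 1 ∧ (∀ α, IsUniformlyCoherent (k α) (ψ α)) ∧
        ∑ α, (p α : ℂ) • pureDensity (ψ α) = ρ ∧ v = ∑ α, p α * Real.logb 2 (k α) := by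
  constructor
  · intro h
    obtain ⟨κ, _, w, z, hw, hw1, hz, hsum⟩ := mem_convexHull_iff_exists_fintype.1 h
    choose k ψ hψ hzψ using hz
    have hfst : ∑ i, (w i • z i).1 = ρ := by rw [← Prod.fst_sum, hsum]
    have hsnd : ∑ i, (w i • z i).2 = v := by rw [← Prod.snd_sum, hsum]
    let e := (Fintype.equivFin κ).symm
    refine ⟨Fintype.card κ, w ∘ e, k ∘ e, ψ ∘ e, fun α => hw _, ?_, fun α => hψ _, ?_, ?_⟩
    · rw [← hw1, ← e.sum_comp w]; rfl
    · rw [← hfst, ← e.sum_comp]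
      exact Finset.sum_congr rfl fun α _ => by
        simp only [Function.comp_apply, Prod.smul_fst, hzψ, Complex.coe_smul]
    · rw [← hsnd, ← e.sum_comp]
      exact Finset.sum_congr rfl fun α _ => by
        simp only [Function.comp_apply, Prod.smul_snd, hzψ, smul_eq_mul]
  · rintro ⟨a, p, k, ψ, hp, hp1, hψ, rfl, rfl⟩
    refine mem_convexHull_of_exists_fintype p
      (fun α => (pureDensity (ψ α), Real.logb 2 (k α))) hp hp1
      (fun α => ⟨k α, ψ α, hψ α, rfl⟩) ?_
    refine Prod.ext ?_ ?_
    · simp only [Prod.fst_sum, Prod.smul_fst, Complex.coe_smul]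
    · simp only [Prod.snd_sum, Prod.smul_snd, smul_eq_mul]

theorem uniformCoherenceOfFormation_eq (ρ : Matrix ι ι ℂ) :
    uniformCoherenceOfFormation ρ = sInf {x : EReal | ∃ v : ℝ,
      (ρ, v) ∈ convexHull ℝ (uniformlyCoherentGraph ι) ∧ x = (v : EReal)} := by
  rw [uniformCoherenceOfFormation]
  congr 1
  ext x
  simp only [Set.mem_ofPred_eq, mem_convexHull_uniformlyCoherentGraph]
  constructor
  · rintro ⟨a, p, k, ψ, hp, hp1, hψ, hρ, rfl⟩
    exact ⟨_, ⟨a, p, k, ψ, hp, hp1, hψ, hρ, rfl⟩, rfl⟩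
  · rintro ⟨_, ⟨a, p, k, ψ, hp, hp1, hψ, hρ, rfl⟩, rfl⟩
    exact ⟨a, p, k, ψ, hp, hp1, hψ, hρ, rfl⟩

/-- `w` has entries of modulus `c` on `J` and vanishes elsewhere. -/
def IsFlatOn (c : ℝ) (J : Finset ι) (w : ι → ℂ) : Prop :=
  ∀ i, ‖w i‖ = if i ∈ J then c else 0

/-- The factor `c ^ 2 * J.card` is the squared norm of `w`, and dividing it out normalises the
state. When it vanishes, any point of the graph will do, and `[Nonempty ι]` supplies one. -/
theorem IsFlatOn.exists_smul_mem_graph [Nonempty ι] {c : ℝ} {J : Finset ι} {w : ι → ℂ}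
    (hw : IsFlatOn c J w) :
    ∃ z ∈ uniformlyCoherentGraph ι, (pureDensity w, c ^ 2 * J.card * Real.logb 2 J.card)
      = (c ^ 2 * J.card) • z := by
  by_cases h : J.Nonempty ∧ c ≠ 0
  · obtain ⟨hJ, hc⟩ := h
    have hc0 : 0 < c := by
      obtain ⟨i, hi⟩ := hJ
      have := hw i
      rw [if_pos hi] at this
      exact lt_of_le_of_ne (this ▸ norm_nonneg _) hc.symm
    have hk : (0 : ℝ) < J.card := by exact_mod_cast hJ.card_pos
    have hs : 0 < Real.sqrt J.card := Real.sqrt_pos.2 hk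
    refine ⟨_, ⟨J.card, fun i => ((1 / (c * Real.sqrt J.card) : ℝ) : ℂ) * w i,
      isUniformlyCoherent_iff.2 ⟨hJ.card_pos, J, rfl, fun i => ?_⟩, rfl⟩, ?_⟩
    · rw [norm_mul, hw i, Complex.norm_real, Real.norm_of_nonneg (by positivity)]
      split_ifs
      · field_simp
      · simp
    · rw [pureDensity_smul, Prod.smul_mk, ← Complex.coe_smul, smul_smul, ← Complex.ofReal_mul]
      have : c ^ 2 * J.card * (1 / (c * Real.sqrt J.card)) ^ 2 = 1 := by
        rw [div_pow, mul_pow, Real.sq_sqrt hk.le]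
        field_simp
      rw [this]
      simp
  · obtain ⟨z, hz⟩ := uniformlyCoherentGraph_nonempty (ι := ι)
    have h0 : c ^ 2 * (J.card : ℝ) = 0 := by
      by_cases hc : c = 0
      · simp [hc]
      · have : J = ∅ := Finset.not_nonempty_iff_eq_empty.1 fun hJ => h ⟨hJ, hc⟩
        simp [this]
    have hw0 : w = 0 := by
      funext i
      rw [Pi.zero_apply, ← norm_eq_zero, hw i]
      split_ifs with hi
      · by_contra hc
        exact h ⟨⟨i, hi⟩, hc⟩
      · rfl
    refine ⟨z, hz, ?_⟩
    rw [h0, zero_smul, zero_mul, hw0]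
    refine Prod.ext ?_ rfl
    ext i j
    simp [pureDensity_apply]

end UniformlyCoherent

/-! ### Flatness under incoherent operations -/

section Incoherent

variable {ι κ : Type*}

theorem mul_pureDensity_mul_conjTranspose [Fintype ι] (A : Matrix κ ι ℂ) (w : ι → ℂ) :
    A * pureDensity w * Aᴴ = pureDensity (A *ᵥ w) := by
  rw [pureDensity, pureDensity, Matrix.mul_vecMulVec, Matrix.vecMulVec_mul, star_mulVec]

theorem conjTranspose_incoherentProjector [DecidableEq ι] (I : Finset ι) :
    (incoherentProjector I)ᴴ = incoherentProjector I := by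
  rw [incoherentProjector, diagonal_conjTranspose]
  congr 1
  funext i
  simp only [Pi.star_apply]
  split_ifs <;> simp

variable [DecidableEq ι] [Fintype κ] [DecidableEq κ]

/-- Each column has a single possibly nonzero entry, of modulus one by normalisation; two columns
meeting in a row would have an inner product of modulus one. -/
theorem isIncoherentIsometry_iff {V : Matrix κ ι ℂ} :
    IsIncoherentIsometry V ↔ ∃ (f : ι → κ) (c : ι → ℂ), f.Injective ∧ (∀ i, ‖c i‖ = 1) ∧
      ∀ j i, V j i = if j = f i then c i else 0 := by
  have hmul : ∀ (f : ι → κ) (c : ι → ℂ), (∀ j i, V j i = if j = f i then c i else 0) →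
      ∀ i i', (Vᴴ * V) i i' = if f i = f i' then star (c i) * c i' else 0 := by
    intro f c hV i i'
    rw [Matrix.mul_apply, Finset.sum_eq_single (f i)]
    · simp [hV]
    · intro j _ hj
      simp [hV, hj]
    · simp
  constructor
  · rintro ⟨⟨f, c, hV⟩, h1⟩
    have h := hmul f c hV
    rw [h1] at h
    have hc : ∀ i, ‖c i‖ = 1 := by
      intro i
      have := h i i
      rw [Matrix.one_apply_eq, if_pos rfl, Complex.star_def, Complex.conj_mul'] at this
      have h2 : ‖c i‖ ^ 2 = 1 := by exact_mod_cast this.symm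
      exact (pow_eq_one_iff_of_nonneg (norm_nonneg _) two_ne_zero).1 h2
    refine ⟨f, c, fun i i' hf => ?_, hc, hV⟩
    by_contra hne
    have := h i i'
    rw [Matrix.one_apply_ne hne, if_pos hf] at this
    have h0 := congrArg norm this
    rw [norm_zero, norm_mul, norm_star, hc, hc] at h0
    norm_num at h0
  · rintro ⟨f, c, hf, hc, hV⟩
    refine ⟨⟨f, c, hV⟩, ?_⟩
    ext i i'
    rw [hmul f c hV, Matrix.one_apply]
    by_cases h : i = i'
    · subst h
      rw [if_pos rfl, if_pos rfl, Complex.star_def, Complex.conj_mul', hc]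
      simp
    · rw [if_neg h, if_neg fun hf' => h (hf hf')]

/-- `w` has entries of modulus `c` on a set of at most `m` labels and vanishes elsewhere. -/
def IsFlat (c : ℝ) (m : ℕ) (w : ι → ℂ) : Prop :=
  ∃ J : Finset ι, J.card ≤ m ∧ IsFlatOn c J w

theorem isFlat_maxCoherent (m : ℕ) : IsFlat (1 / Real.sqrt m) m (maxCoherent m) := by
  refine ⟨Finset.univ, by simp, fun i => ?_⟩
  rw [if_pos (Finset.mem_univ _), maxCoherent, Complex.norm_real,
    Real.norm_of_nonneg (by positivity)]

variable [Fintype ι]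

theorem IsFlat.isometry_mulVec {c : ℝ} {m : ℕ} {w : ι → ℂ} (hw : IsFlat c m w)
    {V : Matrix κ ι ℂ} (hV : IsIncoherentIsometry V) : IsFlat c m (V *ᵥ w) := by
  obtain ⟨f, u, hf, hu, hV⟩ := isIncoherentIsometry_iff.1 hV
  obtain ⟨J, hJ, hw⟩ := hw
  refine ⟨J.image f, Finset.card_image_le.trans hJ, fun j => ?_⟩
  by_cases hj : ∃ i, f i = j
  · obtain ⟨i, rfl⟩ := hj
    have : (V *ᵥ w) (f i) = u i * w i := by
      rw [mulVec, dotProduct, Finset.sum_eq_single i]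
      · rw [hV, if_pos rfl]
      · intro i' _ hi'
        rw [hV, if_neg (fun h => hi' (hf h).symm), zero_mul]
      · simp
    rw [this, norm_mul, hu, one_mul, hw i]
    simp [hf.eq_iff]
  · have : (V *ᵥ w) j = 0 :=
      Finset.sum_eq_zero fun i _ => by 
      simp only [hV, if_neg fun h : j = f i => hj ⟨i, h.symm⟩, zero_mul]
    rw [this, norm_zero, if_neg]
    simp only [Finset.mem_image, not_exists, not_and]
    exact fun i _ h => hj ⟨i, h⟩

/-- Compression reads off the entries in the range of an injection, up to phases: the support may
shrink, but the modulus `c` survives. -/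
theorem IsFlat.conjTranspose_mulVec {c : ℝ} {m : ℕ} {w : κ → ℂ} (hw : IsFlat c m w)
    {W : Matrix κ ι ℂ} (hW : IsIncoherentIsometry W) : IsFlat c m (Wᴴ *ᵥ w) := by
  obtain ⟨f, u, hf, hu, hW⟩ := isIncoherentIsometry_iff.1 hW
  obtain ⟨J, hJ, hw⟩ := hw
  refine ⟨Finset.univ.filter fun i => f i ∈ J,
    (Finset.card_le_card_of_injOn f (fun i hi => by simpa using hi) hf.injOn).trans hJ,
    fun i => ?_⟩
  have : (Wᴴ *ᵥ w) i = star (u i) * w (f i) := by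
    rw [mulVec, dotProduct, Finset.sum_eq_single (f i)]
    · rw [conjTranspose_apply, hW, if_pos rfl]
    · intro j _ hj
      rw [conjTranspose_apply, hW, if_neg hj, star_zero, zero_mul]
    · simp
  rw [this, norm_mul, norm_star, hu, one_mul, hw]
  simp

theorem IsFlat.projector_mulVec {c : ℝ} {m : ℕ} {w : ι → ℂ} (hw : IsFlat c m w) (I : Finset ι) :
    IsFlat c m (incoherentProjector I *ᵥ w) := by
  obtain ⟨J, hJ, hw⟩ := hw
  refine ⟨J ∩ I, (Finset.card_le_card Finset.inter_subset_left).trans hJ, fun i => ?_⟩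
  rw [incoherentProjector, mulVec_diagonal, norm_mul, hw i]
  by_cases h : i ∈ J <;> by_cases h' : i ∈ I <;> simp [h, h']

/-- A physically incoherent operation turns a maximally coherent state into a mixture of pure
states with flat amplitudes. -/
theorem IsPIO.exists_flat_decomposition {m : ℕ}
    {Λ : Matrix (Fin m) (Fin m) ℂ →ₗ[ℂ] Matrix κ κ ℂ} (hΛ : IsPIO Λ) :
    ∃ (a b : ℕ) (q : Fin a → ℝ) (w : Fin a × Fin b → κ → ℂ), (∀ α, 0 ≤ q α) ∧
      (∀ t, IsFlat (1 / Real.sqrt m) m (w t)) ∧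
      Λ (pureDensity (maxCoherent m)) = ∑ t, (q t.1 : ℂ) • pureDensity (w t) := by
  obtain ⟨-, D, Λ', V, W, ⟨a, b, p, U, I, hp, -, hU, -, hΛ'⟩, hV, hW, hΛ⟩ := hΛ
  refine ⟨a, b, p, fun t => Wᴴ *ᵥ U t.1 t.2 *ᵥ incoherentProjector (I t.1 t.2) *ᵥ V *ᵥ maxCoherent m,
    hp, fun t => ?_, ?_⟩
  · exact ((((isFlat_maxCoherent m).isometry_mulVec hV).projector_mulVec _).isometry_mulVec
      (hU _ _)).conjTranspose_mulVec hW
  · rw [hΛ, hΛ', Fintype.sum_prod_type, Matrix.mul_sum, Matrix.sum_mul]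
    refine Finset.sum_congr rfl fun α _ => ?_
    rw [Matrix.mul_sum, Matrix.sum_mul]
    refine Finset.sum_congr rfl fun β _ => ?_
    rw [Matrix.mul_smul, Matrix.smul_mul]
    congr 1
    simp only [← mul_pureDensity_mul_conjTranspose, conjTranspose_incoherentProjector,
      conjTranspose_conjTranspose, Matrix.mul_assoc]

end Incoherent

/-! ### Averaged marginals of mixtures of flat states -/

section Marginal

variable {ι : Type*} [Fintype ι] {m : ℕ}

/-- The reduced matrix of the `i`-th tensor factor. -/
def marginal (i : Fin (m + 1)) (A : Matrix (Fin (m + 1) → ι) (Fin (m + 1) → ι) ℂ) :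
    Matrix ι ι ℂ :=
  Matrix.of fun a b => ∑ y : Fin m → ι, A (i.insertNth a y) (i.insertNth b y)

/-- The average of the reduced matrices of the tensor factors. -/
noncomputable def averageMarginal (A : Matrix (Fin (m + 1) → ι) (Fin (m + 1) → ι) ℂ) :
    Matrix ι ι ℂ :=
  ((m : ℝ) + 1)⁻¹ • ∑ i, marginal i A

theorem averageMarginal_apply (A : Matrix (Fin (m + 1) → ι) (Fin (m + 1) → ι) ℂ) (a b : ι) :
    averageMarginal A a b = ((m : ℝ) + 1)⁻¹ • ∑ i, marginal i A a b := by
  rw [averageMarginal, Matrix.smul_apply, Matrix.sum_apply]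

theorem averageMarginal_sub (A B : Matrix (Fin (m + 1) → ι) (Fin (m + 1) → ι) ℂ) (a b : ι) :
    averageMarginal (A - B) a b = averageMarginal A a b - averageMarginal B a b := by
  simp only [averageMarginal_apply, marginal, Matrix.of_apply, Matrix.sub_apply,
    Finset.sum_sub_distrib, smul_sub]

/-- An entry of a marginal is a sum of entries along two injections `y ↦ i.insertNth a y` and `y ↦
i.insertNth b y`. Hence trace-norm convergence of the outputs gives entrywise convergence of the
averaged marginals. -/
theorem norm_averageMarginal_le [DecidableEq ι]
    (A : Matrix (Fin (m + 1) → ι) (Fin (m + 1) → ι) ℂ) (a b : ι) :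
    ‖averageMarginal A a b‖ ≤ traceNorm A := by
  have hm : (0 : ℝ) < (m : ℝ) + 1 := by positivity
  rw [averageMarginal_apply, norm_smul, Real.norm_of_nonneg (inv_nonneg.2 hm.le),
    inv_mul_le_iff₀ hm]
  refine (norm_sum_le _ _).trans ((Finset.sum_le_card_nsmul _ _ (traceNorm A) ?_).trans_eq ?_)
  · exact fun i _ => norm_sum_apply_le_traceNorm A (Fin.insertNth_right_injective (α := fun _ => ι) a)
      (Fin.insertNth_right_injective (α := fun _ => ι) b)
  · simp

theorem averageMarginal_tensorPower {ρ : Matrix ι ι ℂ} (hρ : ρ.trace = 1) :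
    averageMarginal (tensorPower ρ (m + 1)) = ρ := by
  classical
  have h : ∀ i, marginal i (tensorPower ρ (m + 1)) = ρ := by
    intro i
    ext a b
    simp only [marginal, tensorPower, Matrix.of_apply, Fin.prod_univ_succAbove _ i,
      Fin.insertNth_apply_same, Fin.insertNth_apply_succAbove]
    rw [← Finset.mul_sum, ← Fintype.prod_sum (fun (_ : Fin m) x => ρ x x)]
    have : ∑ x, ρ x x = 1 := hρ
    simp [this]
  have hm : (m : ℝ) + 1 ≠ 0 := by positivity
  ext a b
  rw [averageMarginal_apply]
  simp only [h, Finset.sum_const, Finset.card_univ, Fintype.card_fin, nsmul_eq_mul,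
    Complex.real_smul]
  push_cast
  have : (m : ℂ) + 1 ≠ 0 := by exact_mod_cast hm
  field_simp

/-- The partial trace of a pure state is the sum of the pure states of its slices along lines in
direction `i`. -/
theorem averageMarginal_sum_smul_pureDensity {τ : Type*} [Fintype τ] (q : τ → ℝ)
    (w : τ → (Fin (m + 1) → ι) → ℂ) :
    averageMarginal (∑ t, (q t : ℂ) • pureDensity (w t))
      = ∑ s : τ × Fin (m + 1) × (Fin m → ι), (((m : ℝ) + 1)⁻¹ * q s.1) •
          pureDensity fun a => w s.1 (s.2.1.insertNth a s.2.2) := by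
  ext a b
  rw [averageMarginal_apply, Matrix.sum_apply, Fintype.sum_prod_type]
  simp only [Fintype.sum_prod_type, marginal, Matrix.of_apply, Matrix.sum_apply,
    Matrix.smul_apply, pureDensity_apply, mul_smul, Finset.smul_sum, Complex.coe_smul]
  refine Eq.trans (Finset.sum_congr rfl fun i _ => Finset.sum_comm) Finset.sum_comm

variable [DecidableEq ι]

/-- The number of strings in `J` that agree with `y` away from position `i`. -/
def lineCard (J : Finset (Fin (m + 1) → ι)) (i : Fin (m + 1)) (y : Fin m → ι) : ℕ :=
  (Finset.univ.filter fun a => i.insertNth a y ∈ J).card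

theorem sum_mem_eq_sum_insertNth (J : Finset (Fin (m + 1) → ι)) (i : Fin (m + 1))
    (F : (Fin (m + 1) → ι) → ℝ) :
    ∑ x ∈ J, F x = ∑ y : Fin m → ι, ∑ a with i.insertNth a y ∈ J, F (i.insertNth a y) := by
  have h := (Fin.insertNthEquiv (fun _ => ι) i).sum_comp fun x => if x ∈ J then F x else 0
  rw [Finset.sum_ite_mem, Finset.univ_inter, Fintype.sum_prod_type, Finset.sum_comm] at h
  rw [← h]
  exact Finset.sum_congr rfl fun y _ => (Finset.sum_filter _ _).symm

theorem sum_lineCard (J : Finset (Fin (m + 1) → ι)) (i : Fin (m + 1)) :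
    ∑ y, (lineCard J i y : ℝ) = J.card := by
  simpa [lineCard] using (sum_mem_eq_sum_insertNth J i fun _ => 1).symm

/-- Regroups `sum_log_card_line_le` by lines: a line with `ℓ` points in `J` contributes `log ℓ` once
for each of them. -/
theorem sum_lineCard_mul_log_le (J : Finset (Fin (m + 1) → ι)) :
    ∑ i, ∑ y, (lineCard J i y : ℝ) * Real.log (lineCard J i y) ≤ J.card * Real.log J.card := by
  refine le_trans (le_of_eq ?_) (sum_log_card_line_le Finset.univ J)
  refine Eq.trans (Finset.sum_congr rfl fun i _ => ?_) Finset.sum_comm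
  rw [sum_mem_eq_sum_insertNth J i]
  refine Finset.sum_congr rfl fun y _ => ?_
  simp [lineCard, Fin.update_insertNth]

theorem sum_lineCard_mul_logb_le (J : Finset (Fin (m + 1) → ι)) :
    ∑ i, ∑ y, (lineCard J i y : ℝ) * Real.logb 2 (lineCard J i y)
      ≤ J.card * Real.logb 2 J.card := by
  simp only [Real.logb, ← mul_div_assoc, ← Finset.sum_div]
  exact div_le_div_of_nonneg_right (sum_lineCard_mul_log_le J) (Real.log_nonneg one_le_two)

/-- The averaged marginal of a mixture of flat states has a uniform decomposition whose cost is at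
most the logarithm of the size per tensor factor. -/
theorem exists_averageMarginal_mem_convexHull [Nonempty ι] {τ : Type*} [Fintype τ] {M : ℕ}
    (q : τ → ℝ) (hq : ∀ t, 0 ≤ q t) {c : ℝ} (w : τ → (Fin (m + 1) → ι) → ℂ)
    (hw : ∀ t, IsFlat c M (w t))
    (htr : (∑ t, (q t : ℂ) • pureDensity (w t)).trace = 1) :
    ∃ v ≤ Real.logb 2 M / (m + 1),
      (averageMarginal (∑ t, (q t : ℂ) • pureDensity (w t)), v)
        ∈ convexHull ℝ (uniformlyCoherentGraph ι) := by
  choose J hJM hJ using hw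
  have hm : (0 : ℝ) < (m : ℝ) + 1 := by positivity
  have hsum : ∑ t, q t * (c ^ 2 * (J t).card) = 1 := by
    have h : ∀ t, ∑ x, ‖w t x‖ ^ 2 = c ^ 2 * (J t).card := by
      intro t
      simp only [hJ t _, ite_pow, zero_pow two_ne_zero, Finset.sum_ite_mem, Finset.univ_inter,
        Finset.sum_const, nsmul_eq_mul, mul_comm]
    simp only [Matrix.trace_sum, Matrix.trace_smul, trace_pureDensity, h, smul_eq_mul] at htr
    exact_mod_cast htr
  have hslice : ∀ (t : τ) (i : Fin (m + 1)) (y : Fin m → ι),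
      ∃ z ∈ uniformlyCoherentGraph ι,
        (pureDensity (fun a => w t (i.insertNth a y)),
          c ^ 2 * lineCard (J t) i y * Real.logb 2 (lineCard (J t) i y))
        = (c ^ 2 * lineCard (J t) i y) • z := by
    intro t i y
    have hflat : IsFlatOn c (Finset.univ.filter fun a => i.insertNth a y ∈ J t)
        (fun a => w t (i.insertNth a y)) := fun a => by
      rw [hJ t]
      simp
    exact hflat.exists_smul_mem_graph
  choose z hz hzeq using hslice
  -- The weight of a slice is its squared norm times its coefficient in the averaged marginal; the
  -- weights add up to the trace of the mixture, which is one.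
  let wt : τ × Fin (m + 1) × (Fin m → ι) → ℝ := fun s =>
    ((m : ℝ) + 1)⁻¹ * q s.1 * (c ^ 2 * lineCard (J s.1) s.2.1 s.2.2)
  have hwt : ∀ s, 0 ≤ wt s := fun s =>
    mul_nonneg (mul_nonneg (inv_nonneg.2 hm.le) (hq _)) (mul_nonneg (sq_nonneg c) (Nat.cast_nonneg _))
  have hwt1 : ∑ s, wt s = 1 := by
    simp only [wt, Fintype.sum_prod_type, ← Finset.mul_sum, sum_lineCard]
    refine Eq.trans (Finset.sum_congr rfl fun t _ => ?_) hsum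
    rw [Finset.sum_const, Finset.card_univ, Fintype.card_fin, nsmul_eq_mul]
    push_cast
    field_simp
  refine ⟨∑ s, wt s * Real.logb 2 (lineCard (J s.1) s.2.1 s.2.2), ?_, ?_⟩
  · have hle : ∀ t, q t * (c ^ 2 * ∑ i, ∑ y, (lineCard (J t) i y : ℝ)
        * Real.logb 2 (lineCard (J t) i y)) ≤ q t * (c ^ 2 * (J t).card) * Real.logb 2 M := by
      intro t
      rw [mul_assoc, mul_assoc]
      refine mul_le_mul_of_nonneg_left (mul_le_mul_of_nonneg_left
        ((sum_lineCard_mul_logb_le (J t)).trans ?_) (sq_nonneg c)) (hq t)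
      rcases (J t).card.eq_zero_or_pos with h | h
      · simp [h]
      · refine mul_le_mul_of_nonneg_left ?_ (Nat.cast_nonneg _)
        exact Real.logb_le_logb_of_le one_lt_two (by exact_mod_cast h)
          (by exact_mod_cast hJM t)
    rw [le_div_iff₀ hm]
    calc (∑ s, wt s * Real.logb 2 (lineCard (J s.1) s.2.1 s.2.2)) * (m + 1)
        = ∑ t, q t * (c ^ 2 * ∑ i, ∑ y, (lineCard (J t) i y : ℝ)
            * Real.logb 2 (lineCard (J t) i y)) := by
          simp only [wt, Fintype.sum_prod_type, Finset.sum_mul, Finset.mul_sum]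
          refine Finset.sum_congr rfl fun t _ => Finset.sum_congr rfl fun i _ =>
            Finset.sum_congr rfl fun y _ => ?_
          field_simp
      _ ≤ ∑ t, q t * (c ^ 2 * (J t).card) * Real.logb 2 M := Finset.sum_le_sum fun t _ => hle t
      _ = Real.logb 2 M := by rw [← Finset.sum_mul, hsum, one_mul]
  · refine mem_convexHull_of_exists_fintype wt (fun s => z s.1 s.2.1 s.2.2) hwt hwt1
      (fun s => hz _ _ _) ?_
    have h : ∀ s : τ × Fin (m + 1) × (Fin m → ι), wt s • z s.1 s.2.1 s.2.2
        = ((((m : ℝ) + 1)⁻¹ * q s.1) • pureDensity (fun a => w s.1 (s.2.1.insertNth a s.2.2)),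
          wt s * Real.logb 2 (lineCard (J s.1) s.2.1 s.2.2)) := by
      intro s
      simp only [wt]
      rw [mul_smul, ← hzeq, Prod.smul_mk, smul_eq_mul]
      congr 1
      ring
    rw [averageMarginal_sum_smul_pureDensity, Finset.sum_congr rfl fun s _ => h s]
    exact Prod.ext Prod.fst_sum Prod.snd_sum

end Marginal

/-! ### Building physically incoherent operations -/

section Construction

variable {ι κ : Type*}

/-- The Kraus operator `∑ c i |f i⟩⟨i|`, summed over the labels `i` in the block `β`. -/
def blockKraus [DecidableEq κ] {b : ℕ} (blk : ι → Fin b) (f : ι → κ) (c : ι → ℂ) (β : Fin b) :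
    Matrix κ ι ℂ :=
  Matrix.of fun x i => if blk i = β ∧ x = f i then c i else 0

/-- `hf` says that `f` is injective on each block, so each operator is isometric on its block and
zero on the other labels. -/
theorem sum_conjTranspose_blockKraus_mul_self [DecidableEq ι] [Fintype κ] [DecidableEq κ] {b : ℕ}
    {blk : ι → Fin b} {f : ι → κ} {c : ι → ℂ} (hc : ∀ i, ‖c i‖ = 1)
    (hf : Function.Injective fun i => (blk i, f i)) :
    ∑ β, (blockKraus blk f c β)ᴴ * blockKraus blk f c β = 1 := by
  ext i i'
  have h : ∀ β, ((blockKraus blk f c β)ᴴ * blockKraus blk f c β) i i'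
      = if blk i = β then if i = i' then 1 else 0 else 0 := by
    intro β
    rw [Matrix.mul_apply]
    simp only [Matrix.conjTranspose_apply, blockKraus, Matrix.of_apply]
    by_cases hβ : blk i = β
    · rw [Finset.sum_eq_single (f i), if_pos ⟨hβ, rfl⟩, if_pos hβ]
      · by_cases hi : i = i'
        · subst hi
          rw [if_pos ⟨hβ, rfl⟩, if_pos rfl, Complex.star_def, Complex.conj_mul', hc]
          simp
        · rw [if_neg hi, if_neg, mul_zero]
          rintro ⟨h1, h2⟩
          exact hi (hf (Prod.ext (hβ.trans h1.symm) h2))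
      · intro x _ hx
        rw [if_neg fun h => hx h.2, star_zero, zero_mul]
      · simp
    · rw [if_neg hβ]
      exact Finset.sum_eq_zero fun x _ => by rw [if_neg fun h => hβ h.1, star_zero, zero_mul]
  rw [Matrix.sum_apply, Finset.sum_congr rfl fun β _ => h β, Finset.sum_ite_eq, Matrix.one_apply]
  simp

theorem mul_apply_of_monomial [Fintype κ] [DecidableEq κ] {l : Type*} {V : Matrix κ ι ℂ}
    {f : ι → κ} (hV : ∀ j i, V j i = if j = f i then 1 else 0) (A : Matrix l κ ℂ) (k : l) (i : ι) :
    (A * V) k i = A k (f i) := by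
  simp [Matrix.mul_apply, hV]

theorem conjTranspose_mul_apply_of_monomial [Fintype κ] [DecidableEq κ] {l : Type*}
    {V : Matrix κ ι ℂ} {f : ι → κ} (hV : ∀ j i, V j i = if j = f i then 1 else 0)
    (A : Matrix κ l ℂ) (i : ι) (k : l) : (Vᴴ * A) i k = A (f i) k := by
  simp [Matrix.mul_apply, hV]

/-- A partial injection between two finite types, given on a block, extends to a permutation of
their product in which the two types are embedded as axes. -/
theorem exists_perm_extending {D : ℕ} (e : κ × ι ≃ Fin D) (k₀ : κ) (i₀ : ι) (f : ι → κ)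
    (s : Finset ι) (hf : Set.InjOn f s) :
    ∃ σ : Equiv.Perm (Fin D), ∀ i ∈ s, σ (e (k₀, i)) = e (f i, i₀) := by
  obtain ⟨g, hg⟩ := Finset.exists_equiv_extend_of_card_eq (α := Fin D) (t := Finset.univ)
    (by simp) (s := s.image fun i => e (k₀, i)) (f := fun k => e (f (e.symm k).2, i₀))
    (Finset.subset_univ _) (by
      intro k hk k' hk' h
      simp only [Finset.coe_image, Set.mem_image, Finset.mem_coe] at hk hk'
      obtain ⟨i, hi, rfl⟩ := hk
      obtain ⟨i', hi', rfl⟩ := hk'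
      have h2 : f i = f i' := by simpa using h
      rw [hf hi hi' h2])
  refine ⟨g.trans (Equiv.subtypeUnivEquiv Finset.mem_univ), fun i hi => ?_⟩
  have := hg (e (k₀, i)) (Finset.mem_image_of_mem _ hi)
  simpa using this

variable [Fintype ι] [DecidableEq ι] [Fintype κ] [DecidableEq κ]

/-- Random choice of a block measurement, followed by monomial maps that are injective on every
block, is a physically incoherent operation. -/
theorem exists_isPIO_blockKraus [Nonempty ι] [Nonempty κ] {τ : Type*} [Fintype τ] {b : ℕ}
    (q : τ → ℝ) (hq : ∀ α, 0 ≤ q α) (hq1 : ∑ α, q α = 1) (blk : τ → ι → Fin b) (f : τ → ι → κ)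
    (c : τ → ι → ℂ) (hc : ∀ α i, ‖c α i‖ = 1)
    (hf : ∀ α, Function.Injective fun i => (blk α i, f α i)) :
    ∃ Λ : Matrix ι ι ℂ →ₗ[ℂ] Matrix κ κ ℂ, IsPIO Λ ∧ ∀ X, Λ X = ∑ α, ∑ β, (q α : ℂ) •
      (blockKraus (blk α) (f α) (c α) β * X * (blockKraus (blk α) (f α) (c α) β)ᴴ) := by
  obtain ⟨k₀⟩ := ‹Nonempty κ›
  obtain ⟨i₀⟩ := ‹Nonempty ι›
  let e := Fintype.equivFin (κ × ι)
  let r := (Fintype.equivFin τ).symm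
  have hσ : ∀ α β, ∃ σ : Equiv.Perm (Fin (Fintype.card (κ × ι))),
      ∀ i, blk α i = β → σ (e (k₀, i)) = e (f α i, i₀) := by
    intro α β
    obtain ⟨σ, h⟩ := exists_perm_extending e k₀ i₀ (f α) (Finset.univ.filter fun i => blk α i = β)
      (by
        intro i hi i' hi' h
        simp only [Finset.coe_filter, Finset.mem_univ, true_and, Set.mem_ofPred_eq] at hi hi'
        exact hf α (Prod.ext (hi.trans hi'.symm) h))
    exact ⟨σ, fun i hi => h i (by simpa using hi)⟩
  choose σ hσ using hσ
  let V : Matrix (Fin (Fintype.card (κ × ι))) ι ℂ :=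
    Matrix.of fun j i => if j = e (k₀, i) then 1 else 0
  let W : Matrix (Fin (Fintype.card (κ × ι))) κ ℂ :=
    Matrix.of fun j x => if j = e (x, i₀) then 1 else 0
  have hV : ∀ j i, V j i = if j = e (k₀, i) then 1 else 0 := fun _ _ => rfl
  have hW : ∀ j x, W j x = if j = e (x, i₀) then 1 else 0 := fun _ _ => rfl
  -- Input and output sit in `κ × ι` as the axes `k₀` and `i₀`. Phases and blocks depend on the
  -- `ι`-coordinate alone, so they are defined on the whole space and the projectors add up to one
  -- there.
  let U : τ → Fin b → Matrix (Fin (Fintype.card (κ × ι))) (Fin (Fintype.card (κ × ι))) ℂ :=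
    fun α β => Matrix.of fun j k => if j = σ α β k then c α (e.symm k).2 else 0
  let I : τ → Fin b → Finset (Fin (Fintype.card (κ × ι))) :=
    fun α β => Finset.univ.filter fun k => blk α (e.symm k).2 = β
  let K : τ → Fin b → Matrix (Fin (Fintype.card (κ × ι))) (Fin (Fintype.card (κ × ι))) ℂ :=
    fun α β => U α β * incoherentProjector (I α β)
  let Λ' : Matrix (Fin (Fintype.card (κ × ι))) (Fin (Fintype.card (κ × ι))) ℂ →ₗ[ℂ]
      Matrix (Fin (Fintype.card (κ × ι))) (Fin (Fintype.card (κ × ι))) ℂ :=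
    { toFun := fun X => ∑ α, ∑ β, (q α : ℂ) • (K α β * X * (K α β)ᴴ)
      map_add' := fun X Y => by
        simp only [Matrix.mul_add, Matrix.add_mul, smul_add, Finset.sum_add_distrib]
      map_smul' := fun z X => by
        simp only [Matrix.mul_smul, Matrix.smul_mul, Finset.smul_sum, RingHom.id_apply,
          smul_comm z] }
  let Λ : Matrix ι ι ℂ →ₗ[ℂ] Matrix κ κ ℂ :=
    { toFun := fun X => Wᴴ * Λ' (V * X * Vᴴ) * W
      map_add' := fun X Y => by
        simp only [Matrix.mul_add, Matrix.add_mul, map_add]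
      map_smul' := fun z X => by
        simp only [Matrix.mul_smul, Matrix.smul_mul, map_smul, RingHom.id_apply] }
  have hkraus : ∀ α β, Wᴴ * K α β * V = blockKraus (blk α) (f α) (c α) β := by
    intro α β
    ext x i
    rw [mul_apply_of_monomial hV,
      conjTranspose_mul_apply_of_monomial hW]
    simp only [K, incoherentProjector, Matrix.mul_diagonal, U, I, Matrix.of_apply, blockKraus,
      Finset.mem_filter, Finset.mem_univ, true_and, Equiv.symm_apply_apply]
    by_cases hβ : blk α i = β
    · rw [hσ α β i hβ]
      simp [hβ]
    · simp [hβ]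
  have hΛ : ∀ X, Λ X = ∑ α, ∑ β, (q α : ℂ) •
      (blockKraus (blk α) (f α) (c α) β * X * (blockKraus (blk α) (f α) (c α) β)ᴴ) := by
    intro X
    change Wᴴ * (∑ α, ∑ β, (q α : ℂ) • (K α β * (V * X * Vᴴ) * (K α β)ᴴ)) * W = _
    simp only [Matrix.mul_sum, Matrix.sum_mul, Matrix.mul_smul, Matrix.smul_mul, ← hkraus,
      conjTranspose_mul, conjTranspose_conjTranspose, Matrix.mul_assoc]
  refine ⟨Λ, ⟨fun X => ?_, Fintype.card (κ × ι), Λ', V, W, ?_, ?_, ?_, fun X => rfl⟩, hΛ⟩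
  · rw [hΛ, Matrix.trace_sum]
    have h : ∀ α, (∑ β, (q α : ℂ) •
        (blockKraus (blk α) (f α) (c α) β * X * (blockKraus (blk α) (f α) (c α) β)ᴴ)).trace
        = q α * X.trace := by
      intro α
      rw [← Finset.smul_sum, Matrix.trace_smul, Matrix.trace_sum]
      simp only [fun β => Matrix.trace_mul_cycle (blockKraus (blk α) (f α) (c α) β) X]
      rw [← Matrix.trace_sum, ← Finset.sum_mul,
        sum_conjTranspose_blockKraus_mul_self (hc α) (hf α), Matrix.one_mul, smul_eq_mul]
    rw [Finset.sum_congr rfl fun α _ => h α, ← Finset.sum_mul, ← Complex.ofReal_sum, hq1]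
    simp
  · refine ⟨Fintype.card τ, b, q ∘ r, fun α => U (r α), fun α => I (r α), fun α => hq _, ?_, ?_, ?_,
      fun X => ?_⟩
    · rw [← hq1, ← r.sum_comp q]; rfl
    · intro α β
      exact isIncoherentIsometry_iff.2 ⟨σ (r α) β, fun k => c (r α) (e.symm k).2,
        (σ (r α) β).injective, fun k => hc _ _, fun _ _ => rfl⟩
    · intro α
      ext j k
      rw [Matrix.sum_apply]
      by_cases hjk : j = k
      · subst hjk
        simp [incoherentProjector, I]
      · simp [incoherentProjector, hjk]
    · change ∑ α, ∑ β, (q α : ℂ) • (K α β * X * (K α β)ᴴ) = _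
      rw [← r.sum_comp]
      simp only [K, conjTranspose_mul, conjTranspose_incoherentProjector, Matrix.mul_assoc,
        Function.comp_apply]
  · refine isIncoherentIsometry_iff.2 ⟨fun i => e (k₀, i), fun _ => 1, fun i i' h => ?_,
      fun _ => norm_one, fun _ _ => rfl⟩
    simpa using h
  · refine isIncoherentIsometry_iff.2 ⟨fun x => e (x, i₀), fun _ => 1, fun i i' h => ?_,
      fun _ => norm_one, fun _ _ => rfl⟩
    simpa using h

/-- Makes the infimum in `dilutionError` one over a nonempty set, so that near-optimal operations
exist. The witness measures the label completely and prepares `x`. -/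
theorem exists_isPIO [Nonempty ι] [Nonempty κ] :
    ∃ Λ : Matrix ι ι ℂ →ₗ[ℂ] Matrix κ κ ℂ, IsPIO Λ := by
  obtain ⟨x⟩ := ‹Nonempty κ›
  obtain ⟨Λ, hΛ, -⟩ := exists_isPIO_blockKraus (κ := κ) (τ := Unit) (fun _ => 1)
    (fun _ => zero_le_one) (by simp) (fun _ => Fintype.equivFin ι) (fun _ _ => x) (fun _ _ => 1)
    (fun _ _ => norm_one) fun _ i i' h => (Fintype.equivFin ι).injective (congrArg Prod.fst h)
  exact ⟨Λ, hΛ⟩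

end Construction

/-! ### Achievable rates bound the uniform coherence of formation -/

section LowerBound

variable {ι : Type*} [Fintype ι] [DecidableEq ι]

theorem dilutionError_nonneg (ρ : Matrix ι ι ℂ) (m n : ℕ) : 0 ≤ dilutionError ρ m n :=
  Real.iInf_nonneg fun _ => traceNorm_nonneg _

theorem trace_pureDensity_maxCoherent {M : ℕ} (hM : 0 < M) :
    (pureDensity (maxCoherent M)).trace = 1 := by
  have h : (0 : ℝ) < M := by exact_mod_cast hM
  rw [trace_pureDensity]
  simp only [maxCoherent, Complex.norm_real, Real.norm_eq_abs, sq_abs, div_pow, one_pow,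
    Real.sq_sqrt h.le, Finset.sum_const, Finset.card_univ, Fintype.card_fin, nsmul_eq_mul]
  rw [mul_one_div_cancel h.ne', Complex.ofReal_one]

theorem IsPIO.exists_averageMarginal_mem_convexHull [Nonempty ι] {m M : ℕ} (hM : 0 < M)
    {Λ : Matrix (Fin M) (Fin M) ℂ →ₗ[ℂ] Matrix (Fin (m + 1) → ι) (Fin (m + 1) → ι) ℂ}
    (hΛ : IsPIO Λ) :
    ∃ v ≤ Real.logb 2 M / (m + 1), (averageMarginal (Λ (pureDensity (maxCoherent M))), v)
      ∈ convexHull ℝ (uniformlyCoherentGraph ι) := by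
  obtain ⟨a, b, q, w, hq, hw, hsum⟩ := hΛ.exists_flat_decomposition
  have htr : (Λ (pureDensity (maxCoherent M))).trace = 1 := by
    rw [hΛ.1, trace_pureDensity_maxCoherent hM]
  rw [hsum] at htr ⊢
  exact Coherence.exists_averageMarginal_mem_convexHull (τ := Fin a × Fin b) (M := M)
    (c := 1 / Real.sqrt M) (fun t => q t.1) (fun t => hq t.1) w hw htr

/-- An achievable dilution rate bounds the cost of some uniform decomposition. -/
theorem IsDilutionRate.exists_le_mem_convexHull [Nonempty ι] {ρ : Matrix ι ι ℂ}
    (hρ : ρ.trace = 1) {r : ℝ} (hr : IsDilutionRate ρ r) :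
    ∃ v ≤ r, (ρ, v) ∈ convexHull ℝ (uniformlyCoherentGraph ι) := by
  obtain ⟨hr0, hlim⟩ := hr
  -- `X` is the averaged marginal of a PIO output for `m + 1` copies that is optimal up to `1 / (m +
  -- 1)`. At least one copy is needed for a marginal to exist.
  have hstep : ∀ m : ℕ, ∃ X : Matrix ι ι ℂ,
      X ∈ Prod.fst '' (convexHull ℝ (uniformlyCoherentGraph ι) ∩ {z | z.2 ≤ r}) ∧
      ∀ a b, ‖X a b - ρ a b‖ ≤ dilutionError ρ ⌊r * (m + 1 : ℕ)⌋₊ (m + 1) + 1 / ((m : ℝ) + 1) := by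
    intro m
    set N := ⌊r * (m + 1 : ℕ)⌋₊
    have hm : (0 : ℝ) < (m : ℝ) + 1 := by positivity
    have : Nonempty {Λ : Matrix (Fin (2 ^ N)) (Fin (2 ^ N)) ℂ →ₗ[ℂ]
        Matrix (Fin (m + 1) → ι) (Fin (m + 1) → ι) ℂ // IsPIO Λ} :=
      (exists_isPIO (ι := Fin (2 ^ N)) (κ := Fin (m + 1) → ι)).elim fun Λ hΛ => ⟨⟨Λ, hΛ⟩⟩
    obtain ⟨⟨Λ, hΛ⟩, hlt⟩ := exists_lt_of_ciInf_lt
      (lt_add_of_pos_right (dilutionError ρ N (m + 1)) (one_div_pos.2 hm))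
    obtain ⟨v, hv, hmem⟩ := hΛ.exists_averageMarginal_mem_convexHull (pow_pos two_pos N)
    have hvr : v ≤ r := by
      refine hv.trans ?_
      rw [div_le_iff₀ hm, Nat.cast_pow, Nat.cast_ofNat, Real.logb_pow,
        Real.logb_self_eq_one one_lt_two, mul_one]
      exact (Nat.floor_le (mul_nonneg hr0 (Nat.cast_nonneg (m + 1)))).trans_eq (by push_cast; rfl)
    refine ⟨_, ⟨(_, v), ⟨hmem, hvr⟩, rfl⟩, fun i j => ?_⟩
    · have h := norm_averageMarginal_le
        (Λ (pureDensity (maxCoherent (2 ^ N))) - tensorPower ρ (m + 1)) i j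
      rw [averageMarginal_sub, averageMarginal_tensorPower hρ] at h
      exact h.trans hlt.le
  choose X hX hXρ using hstep
  have hcompact : IsCompact (Prod.fst '' (convexHull ℝ (uniformlyCoherentGraph ι) ∩ {z | z.2 ≤ r})) :=
    ((isCompact_convexHull_of_finiteDimensional isCompact_uniformlyCoherentGraph).inter_right
      (isClosed_le continuous_snd continuous_const)).image continuous_fst
  have hXlim : Tendsto X atTop (𝓝 ρ) := by
    have herr : Tendsto (fun m : ℕ =>
        dilutionError ρ ⌊r * (m + 1 : ℕ)⌋₊ (m + 1) + 1 / ((m : ℝ) + 1)) atTop (𝓝 0) := by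
      simpa using (hlim.comp (tendsto_add_atTop_nat 1)).add
        (tendsto_one_div_add_atTop_nhds_zero_nat (𝕜 := ℝ))
    refine tendsto_pi_nhds.2 fun i => tendsto_pi_nhds.2 fun j => ?_
    rw [tendsto_iff_norm_sub_tendsto_zero]
    exact squeeze_zero (fun _ => norm_nonneg _) (fun m => hXρ m i j) herr
  obtain ⟨⟨_, v⟩, ⟨hv, hvr⟩, rfl⟩ :=
    hcompact.isClosed.mem_of_tendsto hXlim (Eventually.of_forall hX)
  exact ⟨v, hvr, hv⟩

end LowerBound

/-! ### Dilution at every rate above the cost of a decomposition -/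

section UpperBound

variable {κ : Type*}

theorem tensorPower_sum_smul_pureDensity {a : ℕ} (p : Fin a → ℝ) (ψ : Fin a → κ → ℂ) (n : ℕ) :
    tensorPower (∑ α, (p α : ℂ) • pureDensity (ψ α)) n
      = ∑ α : Fin n → Fin a, ((∏ i, p (α i) : ℝ) : ℂ) •
          pureDensity fun x : Fin n → κ => ∏ i, ψ (α i) (x i) := by
  ext x y
  simp only [tensorPower, Matrix.of_apply, Matrix.sum_apply, Matrix.smul_apply, pureDensity_apply,
    smul_eq_mul, star_prod]
  rw [Finset.prod_univ_sum, Fintype.piFinset_univ]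
  refine Finset.sum_congr rfl fun α _ => ?_
  push_cast
  rw [Finset.prod_mul_distrib, Finset.prod_mul_distrib]

variable [DecidableEq κ]

/-- Tensor products of uniformly coherent states are uniformly coherent. -/
theorem isUniformlyCoherent_prod {n : ℕ} {k : Fin n → ℕ} {ψ : Fin n → κ → ℂ}
    (hψ : ∀ i, IsUniformlyCoherent (k i) (ψ i)) :
    IsUniformlyCoherent (∏ i, k i) fun x : Fin n → κ => ∏ i, ψ i (x i) := by
  simp only [isUniformlyCoherent_iff] at hψ ⊢
  choose hk J hJ hψ using hψ
  refine ⟨Finset.one_le_prod' fun i _ => hk i, Fintype.piFinset J, ?_, fun x => ?_⟩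
  · rw [Fintype.card_piFinset]
    exact Finset.prod_congr rfl fun i _ => hJ i
  · rw [norm_prod, Finset.prod_congr rfl fun i _ => hψ i (x i)]
    split_ifs with hx
    · rw [Fintype.mem_piFinset] at hx
      rw [Finset.prod_congr rfl fun i _ => if_pos (hx i), Nat.cast_prod,
        Real.sqrt_prod _ fun i _ => Nat.cast_nonneg _, Finset.prod_div_distrib,
        Finset.prod_const_one]
    · rw [Fintype.mem_piFinset, not_forall] at hx
      obtain ⟨i, hi⟩ := hx
      exact Finset.prod_eq_zero (Finset.mem_univ i) (if_neg hi)

variable [Fintype κ]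

theorem IsUniformlyCoherent.trace_pureDensity {k : ℕ} {φ : κ → ℂ} (hφ : IsUniformlyCoherent k φ) :
    (pureDensity φ).trace = 1 := by
  obtain ⟨hk, J, hJ, h⟩ := isUniformlyCoherent_iff.1 hφ
  have hk0 : (0 : ℝ) < k := by exact_mod_cast hk
  rw [Coherence.trace_pureDensity]
  simp only [h, ite_pow, div_pow, one_pow, Real.sq_sqrt hk0.le, zero_pow two_ne_zero,
    Finset.sum_ite_mem, Finset.univ_inter, Finset.sum_const, hJ, nsmul_eq_mul]
  rw [mul_one_div_cancel hk0.ne', Complex.ofReal_one]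

/-- Cutting the labels `0, …, M - 1` into blocks of size `k` turns the maximally coherent state of
dimension `M` into a given uniformly coherent state of size `k`, up to the incomplete block. -/
theorem IsUniformlyCoherent.exists_blockKraus {M k : ℕ} (hM : 0 < M) {φ : κ → ℂ}
    (hφ : IsUniformlyCoherent k φ) :
    ∃ (blk : Fin M → Fin M) (f : Fin M → κ) (c : Fin M → ℂ) (s : ℝ) (R : Matrix κ κ ℂ),
      (∀ i, ‖c i‖ = 1) ∧ Function.Injective (fun i => (blk i, f i)) ∧
      s ≤ 1 ∧ 1 - s ≤ min 1 ((k : ℝ) / M) ∧ R.PosSemidef ∧ R.trace = ((1 - s : ℝ) : ℂ) ∧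
      ∑ β, blockKraus blk f c β * pureDensity (maxCoherent M) * (blockKraus blk f c β)ᴴ
        = (s : ℂ) • pureDensity φ + R := by
  obtain ⟨hk, J, θ, hJ, hφ'⟩ := id hφ
  have hk0 : 0 < k := hk
  have hMR : (0 : ℝ) < M := by exact_mod_cast hM
  have hkR : (0 : ℝ) < k := by exact_mod_cast hk0
  let g : Fin k ≃ J := (J.equivFinOfCardEq hJ).symm
  -- Division with remainder: the quotient of `i` by `k` names the block, and the remainder picks
  -- the element of `J`.
  let blk : Fin M → Fin M := fun i => ⟨i / k, (Nat.div_le_self _ _).trans_lt i.2⟩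
  let f : Fin M → κ := fun i => g ⟨i % k, Nat.mod_lt _ hk0⟩
  let c : Fin M → ℂ := fun i => Complex.exp (θ (f i) * Complex.I)
  have hc : ∀ i, ‖c i‖ = 1 := fun i => Complex.norm_exp_ofReal_mul_I _
  have hinj : Function.Injective fun i => (blk i, f i) := by
    intro i i' h
    have h1 : (i : ℕ) / k = i' / k := congrArg (fun z : Fin M × κ => (z.1 : ℕ)) h
    have h2 : (i : ℕ) % k = i' % k := by
      have := g.injective (Subtype.ext (congrArg Prod.snd h))
      exact congrArg Fin.val this
    exact Fin.ext (by rw [← Nat.div_add_mod (i : ℕ) k, h1, h2, Nat.div_add_mod])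
  have hfull : ∀ β : Fin M, (β : ℕ) < M / k → blockKraus blk f c β *ᵥ maxCoherent M
      = fun x => ((Real.sqrt (k / M) : ℝ) : ℂ) * φ x := by
    intro β hβ
    funext x
    rw [mulVec, dotProduct, hφ' x]
    simp only [blockKraus, Matrix.of_apply, maxCoherent]
    by_cases hx : x ∈ J
    · have hlt : k * β + g.symm ⟨x, hx⟩ < M := by
        have h1 : k * (β + 1) ≤ M :=
          (Nat.mul_le_mul_left k (Nat.succ_le_of_lt hβ)).trans (Nat.mul_div_le M k)
        have h2 := (g.symm ⟨x, hx⟩).2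
        rw [Nat.mul_add, Nat.mul_one] at h1
        omega
      have hblk : blk ⟨k * β + g.symm ⟨x, hx⟩, hlt⟩ = β := by
        refine Fin.ext ?_
        change (k * β + g.symm ⟨x, hx⟩) / k = (β : ℕ)
        rw [Nat.mul_add_div hk0, Nat.div_eq_of_lt (g.symm ⟨x, hx⟩).2, Nat.add_zero]
      have hf : f ⟨k * β + g.symm ⟨x, hx⟩, hlt⟩ = x := by
        have : (⟨(k * β + g.symm ⟨x, hx⟩) % k, Nat.mod_lt _ hk0⟩ : Fin k) = g.symm ⟨x, hx⟩ :=
          Fin.ext (by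
            change (k * β + g.symm ⟨x, hx⟩) % k = _
            rw [Nat.mul_add_mod, Nat.mod_eq_of_lt (g.symm ⟨x, hx⟩).2])
        change ((g ⟨(k * β + g.symm ⟨x, hx⟩) % k, Nat.mod_lt _ hk0⟩ : J) : κ) = x
        rw [this, Equiv.apply_symm_apply]
      rw [Finset.sum_eq_single ⟨k * β + g.symm ⟨x, hx⟩, hlt⟩, if_pos ⟨hblk, hf.symm⟩, if_pos hx]
      · have hsq : (1 / Real.sqrt M : ℝ) = Real.sqrt (k / M) * (1 / Real.sqrt k) := by
          rw [Real.sqrt_div hkR.le]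
          have := (Real.sqrt_pos.2 hkR).ne'
          field_simp
        simp only [c]
        rw [hf, hsq]
        push_cast
        ring
      · intro i _ hi
        rw [if_neg, zero_mul]
        rintro ⟨h1, h2⟩
        exact hi (hinj (Prod.ext (h1.trans hblk.symm) (h2.symm.trans hf.symm)))
      · simp
    · rw [if_neg hx, mul_zero]
      refine Finset.sum_eq_zero fun i _ => ?_
      rw [if_neg, zero_mul]
      rintro ⟨-, rfl⟩
      exact hx (g _).2
  -- Each of the `M / k` complete blocks (natural-number division) occurs with probability `k / M`;
  -- `R` collects the rest, of weight `(M % k) / M`. For `k > M` there is no complete block and `s =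
  -- 0`.
  set s : ℝ := ((M / k : ℕ) : ℝ) * (k / M) with hs
  set R : Matrix κ κ ℂ := ∑ β ∈ Finset.univ.filter fun β : Fin M => ¬ (β : ℕ) < M / k,
    pureDensity (blockKraus blk f c β *ᵥ maxCoherent M) with hR
  have hsum : ∑ β, blockKraus blk f c β * pureDensity (maxCoherent M) * (blockKraus blk f c β)ᴴ
      = (s : ℂ) • pureDensity φ + R := by
    simp only [mul_pureDensity_mul_conjTranspose]
    rw [← Finset.sum_filter_add_sum_filter_not Finset.univ fun β : Fin M => (β : ℕ) < M / k]
    congr 1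
    rw [Finset.sum_congr rfl fun β hβ => by
      rw [hfull β (Finset.mem_filter.1 hβ).2, pureDensity_smul, Real.sq_sqrt (by positivity)]]
    have hcard : (Finset.univ.filter fun β : Fin M => (β : ℕ) < M / k).card = M / k := by
      rw [Fin.card_filter_val_lt, min_eq_right (Nat.div_le_self _ _)]
    rw [Finset.sum_const, hcard, ← Nat.cast_smul_eq_nsmul ℂ, smul_smul, hs]
    push_cast
    rfl
  have htr : R.trace = ((1 - s : ℝ) : ℂ) := by
    have h := congrArg Matrix.trace hsum
    rw [Matrix.trace_sum, Matrix.trace_add, Matrix.trace_smul, hφ.trace_pureDensity] at h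
    simp only [fun β => Matrix.trace_mul_cycle (blockKraus blk f c β)
      (pureDensity (maxCoherent M))] at h
    rw [← Matrix.trace_sum, ← Finset.sum_mul, sum_conjTranspose_blockKraus_mul_self hc hinj,
      Matrix.one_mul, trace_pureDensity_maxCoherent hM] at h
    push_cast
    rw [h]
    simp
  have hs1 : 1 - s = ((M % k : ℕ) : ℝ) / M := by
    have h : (k : ℝ) * (M / k : ℕ) + (M % k : ℕ) = M := by exact_mod_cast Nat.div_add_mod M k
    rw [hs, eq_div_iff hMR.ne']
    field_simp
    linarith
  refine ⟨blk, f, c, s, R, hc, hinj, ?_, ?_, ?_, htr, hsum⟩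
  · have : 0 ≤ 1 - s := by rw [hs1]; positivity
    linarith
  · rw [hs1]
    refine le_min ((div_le_one hMR).2 (by exact_mod_cast Nat.mod_le M k)) ?_
    exact div_le_div_of_nonneg_right (by exact_mod_cast (Nat.mod_lt M hk0).le) hMR.le
  · exact Matrix.posSemidef_sum _ fun β _ => posSemidef_pureDensity _

/-- A mixture of uniformly coherent states can be prepared from a maximally coherent state, with an
error controlled by the ratios of the sizes. -/
theorem exists_isPIO_traceNorm_sub_le [Nonempty κ] {τ : Type*} [Fintype τ] {M : ℕ} (hM : 0 < M)
    (q : τ → ℝ) (hq : ∀ α, 0 ≤ q α) (hq1 : ∑ α, q α = 1) (k : τ → ℕ) (φ : τ → κ → ℂ)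
    (hφ : ∀ α, IsUniformlyCoherent (k α) (φ α)) :
    ∃ Λ : Matrix (Fin M) (Fin M) ℂ →ₗ[ℂ] Matrix κ κ ℂ, IsPIO Λ ∧
      traceNorm (Λ (pureDensity (maxCoherent M)) - ∑ α, (q α : ℂ) • pureDensity (φ α))
        ≤ 2 * ∑ α, q α * min 1 ((k α : ℝ) / M) := by
  choose blk f c s R hc hinj hs1 hs hR htr hsum using fun α => (hφ α).exists_blockKraus hM
  have : Nonempty (Fin M) := ⟨⟨0, hM⟩⟩
  obtain ⟨Λ, hΛ, hΛX⟩ := exists_isPIO_blockKraus q hq hq1 blk f c hc hinj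
  refine ⟨Λ, hΛ, ?_⟩
  -- The error is a difference of two positive matrices, both of trace `∑ q α * (1 - s α)`; hence
  -- the factor `2`.
  have heq : Λ (pureDensity (maxCoherent M)) - ∑ α, (q α : ℂ) • pureDensity (φ α)
      = ∑ α, (q α : ℂ) • R α - ∑ α, ((q α * (1 - s α) : ℝ) : ℂ) • pureDensity (φ α) := by
    rw [hΛX, ← Finset.sum_sub_distrib, ← Finset.sum_sub_distrib]
    refine Finset.sum_congr rfl fun α _ => ?_
    rw [← Finset.smul_sum, hsum]
    push_cast
    module
  have hcoe : ∀ x : ℝ, 0 ≤ x → (0 : ℂ) ≤ x := fun x hx => by exact_mod_cast hx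
  rw [heq]
  refine (traceNorm_sub_le_of_posSemidef
    (Matrix.posSemidef_sum _ fun α _ => (hR α).smul (hcoe _ (hq α)))
    (Matrix.posSemidef_sum _ fun α _ => (posSemidef_pureDensity (φ α)).smul
      (hcoe _ (mul_nonneg (hq α) (sub_nonneg.2 (hs1 α)))))).trans ?_
  simp only [Matrix.trace_sum, Matrix.trace_smul, htr, (hφ _).trace_pureDensity, smul_eq_mul,
    mul_one, ← Complex.ofReal_mul, ← Complex.ofReal_sum, Complex.ofReal_re]
  rw [← two_mul]
  exact mul_le_mul_of_nonneg_left
    (Finset.sum_le_sum fun α _ => mul_le_mul_of_nonneg_left (hs α) (hq α)) zero_le_two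

theorem dilutionError_le {ρ : Matrix κ κ ℂ} {m n : ℕ}
    {Λ : Matrix (Fin (2 ^ m)) (Fin (2 ^ m)) ℂ →ₗ[ℂ] Matrix (Fin n → κ) (Fin n → κ) ℂ}
    (hΛ : IsPIO Λ) : dilutionError ρ m n
      ≤ traceNorm (Λ (pureDensity (maxCoherent (2 ^ m))) - tensorPower ρ n) :=
  ciInf_le (f := fun Λ : {Λ : Matrix (Fin (2 ^ m)) (Fin (2 ^ m)) ℂ →ₗ[ℂ]
      Matrix (Fin n → κ) (Fin n → κ) ℂ // IsPIO Λ} =>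
      traceNorm (Λ.1 (pureDensity (maxCoherent (2 ^ m))) - tensorPower ρ n))
    ⟨0, by rintro _ ⟨_, rfl⟩; exact traceNorm_nonneg _⟩ ⟨Λ, hΛ⟩

/-- The Chernoff trick: the power is multiplicative in `x`, so its average over `n` independent
choices factorises. -/
theorem min_one_le_rpow {x s : ℝ} (hx : 0 < x) (hs0 : 0 ≤ s) (hs1 : s ≤ 1) : min 1 x ≤ x ^ s := by
  rcases le_total 1 x with h | h
  · exact (min_le_left _ _).trans (Real.one_le_rpow h hs0)
  · exact (min_le_right _ _).trans (Real.self_le_rpow_of_le_one hx.le h hs1)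

/-- If the geometric mean of `b` with weights `p` is less than one, then so is a power mean. -/
theorem exists_sum_mul_rpow_lt_one {a : ℕ} {p b : Fin a → ℝ} (hp1 : ∑ α, p α = 1)
    (hb : ∀ α, 0 < b α) (h : ∑ α, p α * Real.log (b α) < 0) :
    ∃ s : ℝ, 0 < s ∧ s ≤ 1 ∧ ∑ α, p α * b α ^ s < 1 := by
  -- The sum equals one at `s = 0` and has negative derivative there, so it drops below one for
  -- small `s > 0`.
  have hd : HasDerivAt (fun s : ℝ => ∑ α, p α * b α ^ s) (∑ α, p α * Real.log (b α)) 0 := by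
    refine HasDerivAt.fun_sum fun α _ => ?_
    simpa using ((hasDerivAt_id (0 : ℝ)).const_rpow (hb α)).const_mul (p α)
  have hev : ∀ᶠ s in 𝓝[>] (0 : ℝ), slope (fun s : ℝ => ∑ α, p α * b α ^ s) 0 s < 0 :=
    ((hasDerivAt_iff_tendsto_slope.1 hd).mono_left
      (nhdsWithin_mono _ fun _ hx => ne_of_gt hx)).eventually_lt_const h
  obtain ⟨s, hs, hs0, hs1⟩ := (hev.and (Ioc_mem_nhdsGT one_pos)).exists
  refine ⟨s, hs0, hs1, ?_⟩
  rw [slope_def_field, sub_zero, div_lt_iff₀ hs0, zero_mul, sub_neg] at hs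
  simpa [hp1] using hs

theorem isDilutionRate_of_mem_convexHull [Nonempty κ] {ρ : Matrix κ κ ℂ} {v r : ℝ}
    (h : (ρ, v) ∈ convexHull ℝ (uniformlyCoherentGraph κ)) (hr : v < r) : IsDilutionRate ρ r := by
  obtain ⟨a, p, k, ψ, hp, hp1, hψ, rfl, rfl⟩ := mem_convexHull_uniformlyCoherentGraph.1 h
  have hk : ∀ α, (0 : ℝ) < k α := fun α => by exact_mod_cast (hψ α).1
  have hr0 : 0 ≤ r := (Finset.sum_nonneg fun α _ => mul_nonneg (hp α)
    (Real.logb_nonneg one_lt_two (by exact_mod_cast (hψ α).1))).trans hr.le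
  have h2r : (0 : ℝ) < 2 ^ r := by positivity
  have hlog2 : 0 < Real.log 2 := Real.log_pos one_lt_two
  -- With `b α = k α / 2 ^ r` the mean logarithm is `(v - r) * log 2`, negative because `v < r`.
  obtain ⟨s, hs0, hs1, hγ⟩ := exists_sum_mul_rpow_lt_one (b := fun α => k α / 2 ^ r) hp1
    (fun α => div_pos (hk α) h2r) (by
      have h1 : ∀ α, p α * Real.log (k α / 2 ^ r)
          = (p α * Real.logb 2 (k α)) * Real.log 2 - p α * (r * Real.log 2) := by
        intro α
        rw [Real.log_div (hk α).ne' h2r.ne', Real.log_rpow two_pos, mul_assoc, Real.logb,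
          div_mul_cancel₀ _ hlog2.ne', mul_sub]
      rw [Finset.sum_congr rfl fun α _ => h1 α, Finset.sum_sub_distrib, ← Finset.sum_mul,
        ← Finset.sum_mul, hp1, one_mul, sub_neg]
      exact mul_lt_mul_of_pos_right hr hlog2)
  set γ := ∑ α, p α * (k α / 2 ^ r : ℝ) ^ s
  have hγ0 : 0 ≤ γ := Finset.sum_nonneg fun α _ =>
    mul_nonneg (hp α) (Real.rpow_nonneg (div_pos (hk α) h2r).le _)
  have hbound : ∀ n : ℕ, dilutionError (∑ α, (p α : ℂ) • pureDensity (ψ α)) ⌊r * n⌋₊ n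
      ≤ 2 * (2 ^ s * γ ^ n) := by
    intro n
    set m := ⌊r * n⌋₊
    obtain ⟨Λ, hΛ, hle⟩ := exists_isPIO_traceNorm_sub_le (κ := Fin n → κ) (pow_pos two_pos m)
      (fun α : Fin n → Fin a => ∏ i, p (α i)) (fun α => Finset.prod_nonneg fun i _ => hp _)
      (by rw [← Fintype.piFinset_univ, ← Finset.prod_univ_sum]; simp [hp1])
      (fun α => ∏ i, k (α i)) (fun α x => ∏ i, ψ (α i) (x i))
      (fun α => isUniformlyCoherent_prod fun i => hψ (α i))
    rw [← tensorPower_sum_smul_pureDensity] at hle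
    refine (dilutionError_le hΛ).trans (hle.trans (mul_le_mul_of_nonneg_left ?_ zero_le_two))
    have hγn : 2 ^ s * γ ^ n
        = ∑ α : Fin n → Fin a, (∏ i, p (α i)) * (2 ^ s * ∏ i, (k (α i) / 2 ^ r : ℝ) ^ s) := by
      have : γ ^ n = ∏ _i : Fin n, γ := by simp
      rw [this, Finset.prod_univ_sum, Fintype.piFinset_univ, Finset.mul_sum]
      refine Finset.sum_congr rfl fun α _ => ?_
      rw [Finset.prod_mul_distrib]
      ring
    rw [hγn]
    refine Finset.sum_le_sum fun α _ => mul_le_mul_of_nonneg_left ?_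
      (Finset.prod_nonneg fun i _ => hp _)
    have hprod : (0 : ℝ) < ∏ i, (k (α i) : ℝ) := Finset.prod_pos fun i _ => hk _
    -- The floor in `m` costs less than one bit; this is the source of the factor `2 ^ s` in
    -- `hbound`.
    have h2m : (2 ^ r : ℝ) ^ n / 2 ≤ 2 ^ m := by
      rw [div_le_iff₀ two_pos, ← pow_succ, ← Real.rpow_natCast, ← Real.rpow_mul two_pos.le,
        ← Real.rpow_natCast]
      refine Real.rpow_le_rpow_of_exponent_le one_le_two ?_
      push_cast
      exact (Nat.lt_floor_add_one _).le
    push_cast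
    refine (min_one_le_rpow (by positivity) hs0.le hs1).trans ?_
    rw [Real.finsetProd_rpow _ _ fun i _ => (div_pos (hk _) h2r).le,
      ← Real.mul_rpow two_pos.le (Finset.prod_nonneg fun i _ => (div_pos (hk _) h2r).le)]
    refine Real.rpow_le_rpow (by positivity) ?_ hs0.le
    rw [Finset.prod_div_distrib, Finset.prod_const, Finset.card_univ, Fintype.card_fin]
    calc (∏ i, (k (α i) : ℝ)) / 2 ^ m ≤ (∏ i, (k (α i) : ℝ)) / ((2 ^ r) ^ n / 2) :=
          div_le_div_of_nonneg_left hprod.le (by positivity) h2m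
      _ = 2 * ((∏ i, (k (α i) : ℝ)) / (2 ^ r) ^ n) := by field_simp
  refine ⟨hr0, squeeze_zero (fun n => dilutionError_nonneg _ _ _) hbound ?_⟩
  simpa using ((tendsto_pow_atTop_nhds_zero_of_lt_one hγ0 hγ).const_mul (2 ^ s)).const_mul 2

end UpperBound

end Coherence

/-! ### The equality of cost and uniform coherence of formation -/

theorem theorem2 (d : ℕ) (ρ : Matrix (Fin d) (Fin d) ℂ) (hρ : Coherence.IsState ρ) :
    Coherence.coherenceCostPIO ρ = Coherence.uniformCoherenceOfFormation ρ := by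
  -- For `d = 0` the trace is zero, so there is no state.
  have hd : Nonempty (Fin d) := by
    by_contra h
    rw [not_nonempty_iff] at h
    simpa [Matrix.trace] using hρ.2
  rw [Coherence.uniformCoherenceOfFormation_eq, Coherence.coherenceCostPIO]
  apply le_antisymm
  · refine le_sInf ?_
    rintro _ ⟨v, hv, rfl⟩
    refine EReal.le_of_forall_lt_iff_le.1 fun r hr => sInf_le ?_
    exact ⟨r, Coherence.isDilutionRate_of_mem_convexHull hv (by exact_mod_cast hr), rfl⟩
  · refine le_sInf ?_
    rintro _ ⟨r, hr, rfl⟩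
    obtain ⟨v, hvr, hv⟩ := hr.exists_le_mem_convexHull hρ.2
    exact sInf_le_of_le ⟨v, hv, rfl⟩ (EReal.coe_le_coe_iff.2 hvr)
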